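/- Let $k$ be an arbitrary field; Lie algebras are over $k$. For a Lie algebra $\mathfrak g$ write $\mathfrak g^1=\mathfrak g$ and $\mathfrak g^{i+1}=[\mathfrak g,\mathfrak g^i]$. For $p\ge 1$, call $\mathfrak g$ $p$-step nilpotent if $\mathfrak g^p\neq 0$ and $\mathfrak g^{p+1}=0$; its type is then $(n_1,\dots,n_p)$ with $n_i=\dim_k \mathfrak g^i/\mathfrak g^{i+1}$. Let $b_2(\mathfrak g)=\dim_k H^2(\mathfrak g,k)$ be the second Betti number (Chevalley–Eilenberg cohomology with trivial coefficients). Let $\mathfrak f_{n,p}=\mathfrak f_n/\mathfrak f_n^{p+1}$ be the free $p$-step nilpotent Lie algebra on $n$ generators, where $\mathfrak f_n$ is the free Lie algebra on $n$ generators, and let $H_r\subseteq\mathfrak f_{n,p}$ be the span of the Lie monomials (iterated brackets) of degree $r$ in the generators. Let $\mathfrak g$ be a finite-dimensional $p$-step nilpotent Lie algebra of type $(n_1,\dots,n_p)$ and dimension $m$. A free $p$-step nilpotent extension of $\mathfrak g$ is a short exact sequence of Lie algebras $$0\to\mathfrak n\to\mathfrak f_{n_1,p}\xrightarrow{\pi}\mathfrak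 g\to 0\qquad\text{with } \mathfrak n\subseteq[\mathfrak f_{n_1,p},\mathfrak f_{n_1,p}].$$ The depth of $\mathfrak g$ is the largest $d\in\{2,\dots,p\}$ such that $\mathfrak n\subseteq\mathfrak f_{n_1,p}^{\,d}$ for a free $p$-step nilpotent extension of $\mathfrak g$ (if $\mathfrak n=0$ and $p\ge2$ this is $d=p$; if $p=1$ there is no depth). Put $C=\binom{n_1}{2}+(m-n_1)(n_1-1)$. Then $$b_2(\mathfrak g)\le C .$$ Suppose moreover that $\mathfrak g$ has depth $d$, and put $c=b_2(\mathfrak f_{n_1,d-1})-n_d$. Then: 1. $c\le b_2(\mathfrak g)\le C$. 2. If, for some free $p$-step nilpotent extension of $\mathfrak g$, the kernel $\mathfrak n$ is generated as an ideal by elements of $H_d$ (for instance by Lie monomials of degree $d$), then $$c\le b_2(\mathfrak g)\le\min\{c+b_2(\mathfrak f_{n_1,p})-b_2(\mathfrak f_{n_1,p-1})+n_p,\;C\}.$$ 3. If $d=p$, then $$c+\max\{0,\;b_2(\mathfrak f_{n_1,p})-n_1b_2(\mathfrak f_{n_1,p-1})+n_1n_p\}\le b_2(\mathfrak g)\le\min\{c+b_2(\mathfrak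 f_{n_1,p})-b_2(\mathfrak f_{n_1,p-1})+n_p,\;C\}.$$ -/

import Mathlib

set_option maxSynthPendingDepth 3

noncomputable section

namespace NilpotentBetti

universe u v w

section General

variable (k : Type u) [Field k] (L : Type v) [LieRing L] [LieAlgebra k L]

/-- The `i`-th term of the lower central series in the indexing that starts at one: it is `L`
for `i = 1`, and the term for `i + 1` is the bracket of `L` with the term for `i`. Mathlib's
series starts at zero, hence the shift; the index `i = 0` is never used. -/
abbrev lcsTerm (i : ℕ) : LieIdeal k L :=
  LieModule.lowerCentralSeries k L L (i - 1)

/-- `L` is `p`-step nilpotent: `p` is positive, the `p`-th term of the lower central series is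
nonzero and the next one vanishes. -/
def IsStepNilpotent (p : ℕ) : Prop :=
  1 ≤ p ∧ lcsTerm k L p ≠ ⊥ ∧ lcsTerm k L (p + 1) = ⊥

/-- The dimension of the quotient of the `i`-th by the `(i + 1)`-st term of the lower central
series, for `i ≥ 1`. -/
def lcsQuotientDim (i : ℕ) : ℕ :=
  Module.finrank k
    ((lcsTerm k L i).toSubmodule ⧸
      (lcsTerm k L (i + 1)).toSubmodule.submoduleOf (lcsTerm k L i).toSubmodule)

/-- `L` has type `(n 1, …, n p)`. -/
def HasType (p : ℕ) (n : ℕ → ℕ) : Prop :=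
  ∀ i, 1 ≤ i → i ≤ p → n i = lcsQuotientDim k L i

/-- The 2-coboundaries with coefficients in the trivial module `k`, inside the 2-cocycles. -/
def twoCoboundary :
    Submodule k (LieModule.Cohomology.twoCocycle k L (TrivialLieModule k L k)) :=
  (LinearMap.range (LieModule.Cohomology.d₁₂ k L (TrivialLieModule k L k))).submoduleOf
    (LieModule.Cohomology.twoCocycle k L (TrivialLieModule k L k))

/-- The second Chevalley–Eilenberg cohomology of `L` with coefficients in the trivial module `k`:
the quotient of the 2-cocycles by the 2-coboundaries, all of which are 2-cocycles. -/
abbrev H2 : Type (max u v) :=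
  LieModule.Cohomology.twoCocycle k L (TrivialLieModule k L k) ⧸ twoCoboundary k L

/-- The second Betti number. -/
def b2 : ℕ := Module.finrank k (H2 k L)

end General

section Free

variable (k : Type u) [Field k]

/-- The free `p`-step nilpotent Lie algebra on `n` generators: the quotient of the free Lie
algebra by the `(p + 1)`-st term of its lower central series. -/
abbrev FreeNilpotent (n p : ℕ) : Type u :=
  FreeLieAlgebra k (Fin n) ⧸ lcsTerm k (FreeLieAlgebra k (Fin n)) (p + 1)

/-- The generators of the free nilpotent Lie algebra. -/
def FreeNilpotent.gen (n p : ℕ) (i : Fin n) : FreeNilpotent k n p :=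
  LieSubmodule.Quotient.mk (FreeLieAlgebra.of k i)

/-- `IsLieMonomial x r a`: the element `a` is a Lie monomial of degree `r` in the `x i`, that is,
an iterated bracket, with any arrangement of the brackets, with `r` entries taken from the
`x i`. -/
inductive IsLieMonomial {ι : Type w} {L : Type v} [LieRing L] (x : ι → L) : ℕ → L → Prop
  | gen (i : ι) : IsLieMonomial x 1 (x i)
  | lie {r s : ℕ} {a b : L} (ha : IsLieMonomial x r a) (hb : IsLieMonomial x s b) :
      IsLieMonomial x (r + s) ⁅a, b⁆

/-- The homogeneous component of degree `r` of the free nilpotent Lie algebra: the span of the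
Lie monomials of degree `r` in the generators. -/
def homogeneous (n p r : ℕ) : Submodule k (FreeNilpotent k n p) :=
  Submodule.span k {a | IsLieMonomial (FreeNilpotent.gen k n p) r a}

variable {k}

/-- A free `p`-step nilpotent extension `0 → ker π → f_{n,p} → L → 0` of `L`: the number `n` of
generators is the dimension of `L / [L, L]`, the map `π` is surjective and its kernel is contained
in the derived algebra. -/
structure IsFreeNilpotentExtension {L : Type v} [LieRing L] [LieAlgebra k L] {n p : ℕ}
    (π : FreeNilpotent k n p →ₗ⁅k⁆ L) : Prop where
  rank_eq : n = lcsQuotientDim k L 1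
  surjective : Function.Surjective π
  ker_le : π.ker ≤ lcsTerm k (FreeNilpotent k n p) 2

/-- The ideal `N` of `f_{n,p}` is generated, as an ideal, by elements that are homogeneous of
degree `r`. -/
def GeneratedInDegree {n p : ℕ} (N : LieIdeal k (FreeNilpotent k n p)) (r : ℕ) : Prop :=
  ∃ S : Set (FreeNilpotent k n p), S ⊆ homogeneous k n p r ∧
    N = LieSubmodule.lieSpan k (FreeNilpotent k n p) S

variable (k)

/-- The `p`-step nilpotent Lie algebra `L` has depth `d`: for a free `p`-step nilpotent extension
of `L`, the number `d` is the largest element of `{2, …, p}` such that the kernel is contained in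
the `d`-th term of the lower central series. For a nonzero kernel the bounds on `d` are automatic;
for a free nilpotent `L`, with zero kernel, they make the depth equal to `p`. -/
def HasDepth (L : Type v) [LieRing L] [LieAlgebra k L] (p d : ℕ) : Prop :=
  ∃ (n : ℕ) (π : FreeNilpotent k n p →ₗ⁅k⁆ L), IsFreeNilpotentExtension π ∧
    IsGreatest {i : ℕ | 2 ≤ i ∧ i ≤ p ∧ π.ker ≤ lcsTerm k (FreeNilpotent k n p) i} d

end Free

end NilpotentBetti

end

noncomputable section

namespace NilpotentBetti

universe u v w

open LieModule (lowerCentralSeries)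

attribute [local instance 100] LieRing.ofAssociativeRing

/-! ### Brackets of spans and Lie monomials -/

section Span

variable {k : Type u} [Field k] {L : Type v} [LieRing L] [LieAlgebra k L]

/-! Write `n = n_1`, let `F` be the free `(p+1)`-step nilpotent algebra on `n` generators, and let
`r` be the kernel of `F → f_{n,p} → g`. A 2-cocycle of `g` defines a central extension, to which the
free Lie algebra maps. Hence the pulled-back cocycle has the form `f ⁅a, b⁆`, and `f` descends to
`F` because `g` is `p`-step nilpotent. This gives Hopf's formula `b2 g = dim r / [F, r]`
(`b2_add_finrank_lie_ker`, `exists_form_freeLieAlgebra`). In particular `b2` of `f_{n,q}` is the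
dimension of the first lower central quotient of the free Lie algebra that `f_{n,q}` omits.

The bounds are then estimates of `dim [F, r]`. The bound `C`: for ideals `J ≤ I` with `[F, I] ≤ J`,
`dim [F, I]/[F, J] ≤ n * dim I/J`. Descending from `[F, F]` to `r`, whose codimension there is `m -
n`, each lost dimension costs at most `n - 1`. The bound `c`: if `r ≤ F^d`, then `[F, r] ≤ r ∩
F^(d+1)`, and `c = dim r / (r ∩ F^(d+1))`. The sharper lower bound for `d = p`: apply the first
estimate to `r` and the central top layer `F^(p+1)`. The sharper upper bound: if `ker π` is
generated in degree `d`, then `r` is spanned by its degree `d` part, `[F, r]` and `F^(p+1)`. The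
overlap of the last two contains `⁅x, r ∩ F^p⁆` for a generator `x`, which has dimension at least
`dim (r ∩ F^p)/F^(p+1)`.

The last point needs `ad x` to be injective on the derived algebra of a free Lie algebra
(`eq_zero_of_lie_of_eq_zero`). This is read off in the free associative algebra, into which the free
Lie algebra embeds (`toFreeAlgebra_injective`). The embedding is proved over any field by Lazard
elimination.

Throughout, `lowerCentralSeries _ _ _ i` is the term written with exponent `i + 1` above. -/

theorem lie_mem_of_mem_span {S T : Set L} {P : Submodule k L}
    (h : ∀ a ∈ S, ∀ b ∈ T, ⁅a, b⁆ ∈ P) {a b : L} (ha : a ∈ Submodule.span k S)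
    (hb : b ∈ Submodule.span k T) : ⁅a, b⁆ ∈ P := by
  induction ha, hb using Submodule.span_induction₂ with
  | mem_mem a b ha hb => exact h a ha b hb
  | zero_left b _ => simp
  | zero_right a _ => simp
  | add_left a b c _ _ _ h₁ h₂ => simpa using P.add_mem h₁ h₂
  | add_right a b c _ _ _ h₁ h₂ => simpa using P.add_mem h₁ h₂
  | smul_left t a b _ _ h₁ => simpa using P.smul_mem t h₁
  | smul_right t a b _ _ h₁ => simpa using P.smul_mem t h₁

/-- The span of the Lie monomials of degree at most `s` in the `x i`. -/
def monomialSpan (k : Type u) [Field k] {L : Type v} [LieRing L] [LieAlgebra k L] {ι : Type w}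
    (x : ι → L) (s : ℕ) : Submodule k L :=
  Submodule.span k {a | ∃ r ≤ s, IsLieMonomial x r a}

theorem monomialSpan_mono {ι : Type w} (x : ι → L) {r s : ℕ} (h : r ≤ s) :
    monomialSpan k x r ≤ monomialSpan k x s :=
  Submodule.span_mono fun _ ⟨t, ht, ha⟩ => ⟨t, ht.trans h, ha⟩

theorem lie_mem_monomialSpan {ι : Type w} {x : ι → L} {r s : ℕ} {a b : L}
    (ha : a ∈ monomialSpan k x r) (hb : b ∈ monomialSpan k x s) :
    ⁅a, b⁆ ∈ monomialSpan k x (r + s) := by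
  refine lie_mem_of_mem_span ?_ ha hb
  rintro _ ⟨i, hi, h₁⟩ _ ⟨j, hj, h₂⟩
  exact Submodule.subset_span ⟨i + j, add_le_add hi hj, h₁.lie h₂⟩

theorem IsLieMonomial.one_le {ι : Type w} {x : ι → L} {r : ℕ} {a : L} (h : IsLieMonomial x r a) :
    1 ≤ r := by
  induction h with
  | gen i => exact le_rfl
  | lie _ _ h₁ _ => exact h₁.trans (Nat.le_add_right _ _)

end Span

/-! ### Lazard elimination and the embedding into the free associative algebra -/

section FreeLie

variable (k : Type u) [Field k] {X : Type v}

/-- These elements form a Lie subalgebra containing the generators; lifting the identity through it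
shows that it is everything. -/
theorem exists_mem_monomialSpan (z : FreeLieAlgebra k X) :
    ∃ s, z ∈ monomialSpan k (FreeLieAlgebra.of k) s := by
  let S : LieSubalgebra k (FreeLieAlgebra k X) :=
    { carrier := {z | ∃ s, z ∈ monomialSpan k (FreeLieAlgebra.of k) s}
      zero_mem' := ⟨0, zero_mem _⟩
      add_mem' := fun ⟨r, ha⟩ ⟨s, hb⟩ => ⟨max r s, add_mem
        (monomialSpan_mono _ (le_max_left r s) ha) (monomialSpan_mono _ (le_max_right r s) hb)⟩
      smul_mem' := fun c _ ⟨r, ha⟩ => ⟨r, Submodule.smul_mem _ c ha⟩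
      lie_mem' := fun ⟨r, ha⟩ ⟨s, hb⟩ => ⟨r + s, lie_mem_monomialSpan ha hb⟩ }
  let f : FreeLieAlgebra k X →ₗ⁅k⁆ S := FreeLieAlgebra.lift k fun x =>
    ⟨FreeLieAlgebra.of k x, 1, Submodule.subset_span ⟨1, le_rfl, .gen x⟩⟩
  have h : S.incl.comp f = LieHom.id := by
    ext x
    simp [f]
  have h₂ := (f z).2
  have h₃ : (f z : FreeLieAlgebra k X) = z := congrArg (fun φ => φ z) h
  rwa [h₃] at h₂

/-- The canonical map from the free Lie algebra to the free associative algebra. -/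
def toFreeAlgebra (X : Type v) : FreeLieAlgebra k X →ₗ⁅k⁆ FreeAlgebra k X :=
  FreeLieAlgebra.lift k (FreeAlgebra.ι k)

@[simp]
theorem toFreeAlgebra_of (x : X) :
    toFreeAlgebra k X (FreeLieAlgebra.of k x) = FreeAlgebra.ι k x := by
  simp [toFreeAlgebra]

/-- The free generators `(ad x) ^ i y`, for `y ≠ x`, of the complement of `x` in Lazard's
elimination. -/
def eliminationHom (x : X) :
    FreeLieAlgebra k (ℕ × {y : X // y ≠ x}) →ₗ⁅k⁆ FreeLieAlgebra k X :=
  FreeLieAlgebra.lift k fun q => (fun z => ⁅FreeLieAlgebra.of k x, z⁆)^[q.1]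
    (FreeLieAlgebra.of k (q.2 : X))

theorem eliminationHom_of (x : X) (i : ℕ) (y : {y : X // y ≠ x}) :
    eliminationHom k x (FreeLieAlgebra.of k (i, y)) =
      (fun z => ⁅FreeLieAlgebra.of k x, z⁆)^[i] (FreeLieAlgebra.of k (y : X)) := by
  simp [eliminationHom]

/-- On the new generators `ad x` is the shift `(i, y) ↦ (i + 1, y)`, extended as a derivation, so it
does not raise the degree in them. -/
theorem lie_of_eliminationHom_monomial (x : X) {r : ℕ}
    {a : FreeLieAlgebra k (ℕ × {y : X // y ≠ x})}
    (ha : IsLieMonomial (FreeLieAlgebra.of k) r a) :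
    ∃ b ∈ monomialSpan k (FreeLieAlgebra.of k) r,
      ⁅FreeLieAlgebra.of k x, eliminationHom k x a⁆ = eliminationHom k x b := by
  induction ha with
  | gen q =>
    refine ⟨_, Submodule.subset_span ⟨1, le_rfl, .gen (q.1 + 1, q.2)⟩, ?_⟩
    rw [eliminationHom_of, eliminationHom_of, Function.iterate_succ_apply']
  | @lie r s a b ha hb iha ihb =>
    obtain ⟨a', ha', iha⟩ := iha
    obtain ⟨b', hb', ihb⟩ := ihb
    refine ⟨⁅a', b⁆ + ⁅a, b'⁆, add_mem
      (lie_mem_monomialSpan ha' (Submodule.subset_span ⟨s, le_rfl, hb⟩))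
      (lie_mem_monomialSpan (Submodule.subset_span ⟨r, le_rfl, ha⟩) hb'), ?_⟩
    rw [LieHom.map_lie, leibniz_lie, iha, ihb, map_add, LieHom.map_lie, LieHom.map_lie]

/-- The image under `eliminationHom` of the span of the Lie monomials of degree at most `s`. -/
def eliminationSpan (x : X) (s : ℕ) : Submodule k (FreeLieAlgebra k X) :=
  (monomialSpan k (FreeLieAlgebra.of k) s).map (eliminationHom k x).toLinearMap

theorem eliminationSpan_mono (x : X) {r s : ℕ} (h : r ≤ s) :
    eliminationSpan k x r ≤ eliminationSpan k x s :=
  Submodule.map_mono (monomialSpan_mono _ h)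

theorem lie_of_mem_eliminationSpan (x : X) {s : ℕ} {a : FreeLieAlgebra k X}
    (ha : a ∈ eliminationSpan k x s) : ⁅FreeLieAlgebra.of k x, a⁆ ∈ eliminationSpan k x s := by
  obtain ⟨a, ha, rfl⟩ := ha
  refine Submodule.span_induction (p := fun a _ => ⁅FreeLieAlgebra.of k x,
    (eliminationHom k x).toLinearMap a⁆ ∈ eliminationSpan k x s) ?_ ?_ ?_ ?_ ha
  · rintro a ⟨r, hr, h⟩
    obtain ⟨b, hb, h⟩ := lie_of_eliminationHom_monomial k x h
    exact ⟨b, monomialSpan_mono _ hr hb, h.symm⟩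
  · simp
  · intro a b _ _ h₁ h₂
    simpa using add_mem h₁ h₂
  · intro c a _ h
    simpa using Submodule.smul_mem _ c h

theorem lie_mem_eliminationSpan {x : X} {r s : ℕ} {a b : FreeLieAlgebra k X}
    (ha : a ∈ eliminationSpan k x r) (hb : b ∈ eliminationSpan k x s) :
    ⁅a, b⁆ ∈ eliminationSpan k x (r + s) := by
  obtain ⟨a, ha, rfl⟩ := ha
  obtain ⟨b, hb, rfl⟩ := hb
  exact ⟨⁅a, b⁆, lie_mem_monomialSpan ha hb, LieHom.map_lie _ a b⟩

open Classical in
/-- The substitution that sends the generators in `S` to zero. -/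
def killHom (S : Finset X) : FreeLieAlgebra k X →ₗ⁅k⁆ FreeLieAlgebra k X :=
  FreeLieAlgebra.lift k fun y => if y ∈ S then 0 else FreeLieAlgebra.of k y

open Classical in
theorem killHom_of (S : Finset X) (y : X) :
    killHom k S (FreeLieAlgebra.of k y) = if y ∈ S then 0 else FreeLieAlgebra.of k y := by
  simp [killHom]

/-- A monomial either avoids `x` or contains it. In the second case an occurrence of `x` is absorbed
into a shift, so the degree in the new generators drops by at least one. This drop drives the
induction for the embedding. -/
theorem IsLieMonomial.elimination (x : X) {r : ℕ} {a : FreeLieAlgebra k X}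
    (ha : IsLieMonomial (FreeLieAlgebra.of k) r a) :
    (killHom k {x} a = a ∧ a ∈ eliminationSpan k x r) ∨
    (killHom k {x} a = 0 ∧ (a = FreeLieAlgebra.of k x ∨ a ∈ eliminationSpan k x (r - 1))) := by
  induction ha with
  | gen y =>
    by_cases h : y = x
    · right
      simp [killHom_of, h]
    · left
      refine ⟨by simp [killHom_of, h], FreeLieAlgebra.of k (0, ⟨y, h⟩),
        Submodule.subset_span ⟨1, le_rfl, .gen _⟩, by simp [eliminationHom_of]⟩
  | @lie r s a b ha hb iha ihb =>
    have hr := ha.one_le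
    have hs := hb.one_le
    rcases iha with ⟨h₁, h₂⟩ | ⟨h₁, h₂⟩
    · rcases ihb with ⟨h₃, h₄⟩ | ⟨h₃, h₄⟩
      · exact .inl ⟨by simp [h₁, h₃], lie_mem_eliminationSpan k h₂ h₄⟩
      · refine .inr ⟨by simp [h₃], .inr ?_⟩
        rcases h₄ with rfl | h₄
        · rw [← lie_skew]
          exact neg_mem (eliminationSpan_mono k x (by omega) (lie_of_mem_eliminationSpan k x h₂))
        · exact eliminationSpan_mono k x (by omega) (lie_mem_eliminationSpan k h₂ h₄)
    · refine .inr ⟨by simp [h₁], .inr ?_⟩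
      -- The left factor already accounts for the lost degree, so the weaker degree `s` suffices for
      -- `b`.
      have h₄ : b = FreeLieAlgebra.of k x ∨ b ∈ eliminationSpan k x s := by
        rcases ihb with ⟨-, h⟩ | ⟨-, h | h⟩
        exacts [.inr h, .inl h, .inr (eliminationSpan_mono k x (Nat.sub_le s 1) h)]
      rcases h₂ with rfl | h₂
      · rcases h₄ with rfl | h₄
        · simp
        · exact eliminationSpan_mono k _ (by omega) (lie_of_mem_eliminationSpan k _ h₄)
      · rcases h₄ with rfl | h₄
        · rw [← lie_skew]
          exact neg_mem (eliminationSpan_mono k _ (by omega) (lie_of_mem_eliminationSpan k _ h₂))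
        · exact eliminationSpan_mono k x (by omega) (lie_mem_eliminationSpan k h₂ h₄)

theorem sub_killHom_mem {x : X} {s : ℕ} {z : FreeLieAlgebra k X}
    (hz : z ∈ monomialSpan k (FreeLieAlgebra.of k) (s + 1)) :
    z - killHom k {x} z ∈ Submodule.span k {FreeLieAlgebra.of k x} ⊔ eliminationSpan k x s := by
  refine Submodule.span_induction (p := fun z _ => z - killHom k {x} z ∈
    Submodule.span k {FreeLieAlgebra.of k x} ⊔ eliminationSpan k x s) ?_ ?_ ?_ ?_ hz
  · rintro a ⟨r, hr, h⟩
    rcases h.elimination k x with ⟨h, -⟩ | ⟨h, rfl | h₁⟩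
    · simp [h]
    · rw [h, sub_zero]
      exact Submodule.mem_sup_left (Submodule.mem_span_singleton_self _)
    · rw [h, sub_zero]
      exact Submodule.mem_sup_right (eliminationSpan_mono k x (by omega) h₁)
  · simp
  · intro a b _ _ h₁ h₂
    rw [map_add, add_sub_add_comm]
    exact add_mem h₁ h₂
  · intro c a _ h
    rw [map_smul, ← smul_sub]
    exact Submodule.smul_mem _ c h

/-- The derivation of the free algebra on the `(i, y)` that sends `(i, y)` to `(i + 1, y)`, as an
algebra map to the dual numbers. -/
def shiftHom (Y : Type v) :
    FreeAlgebra k (ℕ × Y) →ₐ[k] TrivSqZeroExt (FreeAlgebra k (ℕ × Y)) (FreeAlgebra k (ℕ × Y)) :=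
  FreeAlgebra.lift k fun q =>
    TrivSqZeroExt.inl (FreeAlgebra.ι k q) + TrivSqZeroExt.inr (FreeAlgebra.ι k (q.1 + 1, q.2))

theorem fst_shiftHom {Y : Type v} (a : FreeAlgebra k (ℕ × Y)) : (shiftHom k Y a).fst = a := by
  have : (TrivSqZeroExt.fstHom k _ _).comp (shiftHom k Y) = AlgHom.id k _ := by
    ext q
    simp [shiftHom]
  exact congrArg (fun f => f a) this

/-- The derivation that is the second component of `shiftHom`. -/
def shift (Y : Type v) : Module.End k (FreeAlgebra k (ℕ × Y)) where
  toFun a := (shiftHom k Y a).snd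
  map_add' a b := by simp
  map_smul' c a := by simp

theorem shift_mul {Y : Type v} (a b : FreeAlgebra k (ℕ × Y)) :
    shift k Y (a * b) = a * shift k Y b + shift k Y a * b := by
  simp [shift, fst_shiftHom]

theorem shift_one {Y : Type v} : shift k Y 1 = 0 := by
  simp [shift]

theorem shift_ι {Y : Type v} (i : ℕ) (y : Y) :
    shift k Y (FreeAlgebra.ι k (i, y)) = FreeAlgebra.ι k (i + 1, y) := by
  simp [shift, shiftHom]

open Classical in
/-- The representation of the free algebra on `X` by operators on the free algebra on the
elimination generators. -/
def eliminationRep (x : X) :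
    FreeAlgebra k X →ₐ[k] Module.End k (FreeAlgebra k (ℕ × {y : X // y ≠ x})) :=
  FreeAlgebra.lift k fun y => if h : y = x then shift k _ else
    LinearMap.mulLeft k (FreeAlgebra.ι k (0, ⟨y, h⟩))

theorem eliminationRep_self (x : X) : eliminationRep k x (FreeAlgebra.ι k x) = shift k _ := by
  simp [eliminationRep]

theorem eliminationRep_ne {x : X} (y : {y : X // y ≠ x}) :
    eliminationRep k x (FreeAlgebra.ι k (y : X)) =
      LinearMap.mulLeft k (FreeAlgebra.ι k (0, y)) := by
  simp [eliminationRep, y.2]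

/-- The commutator of a derivation `D` with left multiplication by `b` is left multiplication by `D
b`. Hence `ad x` becomes the shift, and the associative image of `a` can be recovered from that of
`eliminationHom k x a`. -/
theorem eliminationRep_eliminationHom (x : X) (a : FreeLieAlgebra k (ℕ × {y : X // y ≠ x})) :
    eliminationRep k x (toFreeAlgebra k X (eliminationHom k x a)) =
      LinearMap.mulLeft k (toFreeAlgebra k _ a) := by
  have : ((eliminationRep k x : FreeAlgebra k X →ₗ⁅k⁆ _).comp (toFreeAlgebra k X)).comp
      (eliminationHom k x) =
      (Algebra.lmul k (FreeAlgebra k (ℕ × {y : X // y ≠ x})) :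
        FreeAlgebra k (ℕ × {y : X // y ≠ x}) →ₗ⁅k⁆
          Module.End k (FreeAlgebra k (ℕ × {y : X // y ≠ x}))).comp (toFreeAlgebra k _) := by
    ext1 ⟨i, y⟩
    change eliminationRep k x (toFreeAlgebra k X (eliminationHom k x _)) =
      LinearMap.mulLeft k (toFreeAlgebra k _ _)
    induction i with
    | zero => rw [eliminationHom_of, Function.iterate_zero_apply, toFreeAlgebra_of,
        toFreeAlgebra_of, eliminationRep_ne]
    | succ i ih =>
      rw [eliminationHom_of, Function.iterate_succ_apply', ← eliminationHom_of, LieHom.map_lie,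
        toFreeAlgebra_of, toFreeAlgebra_of, Ring.lie_def, map_sub, map_mul, map_mul, ih,
        eliminationRep_self, toFreeAlgebra_of]
      ext b
      simp [shift_mul, shift_ι]
  exact congrArg (fun f => f a) this

/-- The substitution extends to the free associative algebra, so it preserves the kernel. -/
theorem toFreeAlgebra_killHom (S : Finset X) {z : FreeLieAlgebra k X}
    (hz : toFreeAlgebra k X z = 0) : toFreeAlgebra k X (killHom k S z) = 0 := by
  classical
  let f : FreeAlgebra k X →ₐ[k] FreeAlgebra k X :=
    FreeAlgebra.lift k fun y => if y ∈ S then 0 else FreeAlgebra.ι k y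
  have : (f : FreeAlgebra k X →ₗ⁅k⁆ FreeAlgebra k X).comp (toFreeAlgebra k X) =
      (toFreeAlgebra k X).comp (killHom k S) := by
    ext1 y
    change f (toFreeAlgebra k X _) = toFreeAlgebra k X (killHom k S _)
    rw [killHom_of, toFreeAlgebra_of]
    split_ifs with h <;> simp [f, h]
  have h := congrArg (fun f => f z) this
  change f (toFreeAlgebra k X z) = toFreeAlgebra k X (killHom k S z) at h
  rw [← h, hz, map_zero]

theorem exists_killHom_eq_zero (z : FreeLieAlgebra k X) :
    ∃ S : Finset X, ∀ T, S ⊆ T → killHom k T z = 0 := by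
  classical
  obtain ⟨s, hz⟩ := exists_mem_monomialSpan k z
  refine Submodule.span_induction (p := fun z _ => ∃ S : Finset X, ∀ T, S ⊆ T → killHom k T z = 0)
    ?_ ?_ ?_ ?_ hz
  · rintro a ⟨r, -, ha⟩
    induction ha with
    | gen x => exact ⟨{x}, fun T hT => by
        rw [killHom_of, if_pos (hT (Finset.mem_singleton_self x))]⟩
    | lie _ _ h _ =>
      obtain ⟨S, hS⟩ := h
      exact ⟨S, fun T hT => by rw [LieHom.map_lie, hS T hT, zero_lie]⟩
  · exact ⟨∅, fun T _ => map_zero _⟩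
  · rintro a b _ _ ⟨S, hS⟩ ⟨S', hS'⟩
    exact ⟨S ∪ S', fun T hT => by
      rw [map_add, hS T (Finset.union_subset_left hT), hS' T (Finset.union_subset_right hT),
        add_zero]⟩
  · rintro c a _ ⟨S, hS⟩
    exact ⟨S, fun T hT => by rw [map_smul, hS T hT, smul_zero]⟩

/-- Induction on the degree, over all alphabets at once because elimination changes the alphabet. An
element of the kernel turns out to be unchanged when any generator is set to zero; setting all the
finitely many relevant generators to zero kills it. -/
theorem eq_zero_of_toFreeAlgebra_eq_zero (s : ℕ) : ∀ {X : Type v} {z : FreeLieAlgebra k X},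
    z ∈ monomialSpan k (FreeLieAlgebra.of k) s → toFreeAlgebra k X z = 0 → z = 0 := by
  classical
  induction s with
  | zero =>
    intro X z hz _
    have : {a : FreeLieAlgebra k X | ∃ r ≤ 0, IsLieMonomial (FreeLieAlgebra.of k) r a} = ∅ := by
      ext a
      simp only [Set.mem_ofPred_eq, Set.mem_empty_iff_false, iff_false]
      rintro ⟨r, hr, h⟩
      have := h.one_le
      omega
    rw [monomialSpan, this] at hz
    simpa using hz
  | succ s ih =>
    intro X z hz h₀
    have key (x : X) : killHom k {x} z = z := by
      obtain ⟨_, hu, v, ⟨w, hw, rfl⟩, huv⟩ := Submodule.mem_sup.1 (sub_killHom_mem k (x := x) hz)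
      obtain ⟨c, rfl⟩ := Submodule.mem_span_singleton.1 hu
      have h₁ : toFreeAlgebra k X (z - killHom k {x} z) = 0 := by
        rw [map_sub, h₀, toFreeAlgebra_killHom k _ h₀, sub_zero]
      have h₂ : c • shift k _ + LinearMap.mulLeft k (toFreeAlgebra k _ w) = 0 := by
        rw [← eliminationRep_eliminationHom, ← eliminationRep_self, ← toFreeAlgebra_of,
          ← map_smul, ← map_smul, ← map_add, ← map_add]
        exact (congrArg _ ((congrArg _ huv).trans h₁)).trans (map_zero _)
      -- Evaluation at `1` removes the `x` part, since a derivation kills `1`.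
      have hw₀ : toFreeAlgebra k _ w = 0 := by
        simpa [shift_one] using congrArg (fun f => f 1) h₂
      have hw₁ := ih hw hw₀
      subst hw₁
      simp only [map_zero, add_zero] at huv
      rw [← huv, map_smul, toFreeAlgebra_of] at h₁
      rcases smul_eq_zero.1 h₁ with rfl | h
      · rw [zero_smul] at huv
        exact (sub_eq_zero.1 huv.symm).symm
      · exact absurd h (FreeAlgebra.ι_ne_zero x)
    have key₂ (S : Finset X) : killHom k S z = z := by
      induction S using Finset.induction_on with
      | empty =>
        have : killHom k (∅ : Finset X) = LieHom.id := by
          ext1 y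
          simp [killHom_of]
        simp [this]
      | insert x S _ ihS =>
        have : killHom k (insert x S) = (killHom k S).comp (killHom k {x}) := by
          ext1 y
          by_cases hy : y = x <;> simp [killHom_of, hy]
        rw [this, LieHom.comp_apply, key, ihS]
    obtain ⟨S, hS⟩ := exists_killHom_eq_zero k z
    rw [← key₂ S, hS S subset_rfl]

/-- The free Lie algebra embeds into the free associative algebra. -/
theorem toFreeAlgebra_injective : Function.Injective (toFreeAlgebra k X) := by
  rw [injective_iff_map_eq_zero]
  intro z hz
  obtain ⟨s, hs⟩ := exists_mem_monomialSpan k z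
  exact eq_zero_of_toFreeAlgebra_eq_zero k s hs hz

end FreeLie

/-! ### Lower central series and brackets with generators -/

section LowerCentralSeries

variable {k : Type u} [Field k] {L : Type v} [LieRing L] [LieAlgebra k L]

theorem lie_mem_lowerCentralSeries_succ (x : L) {y : L} {i : ℕ}
    (hy : y ∈ lowerCentralSeries k L L i) : ⁅x, y⁆ ∈ lowerCentralSeries k L L (i + 1) := by
  rw [LieModule.lowerCentralSeries_succ]
  exact LieSubmodule.lie_mem_lie (LieSubmodule.mem_top x) hy

/-- By the Jacobi identity `[[a, b], c] = [a, [b, c]] - [b, [a, c]]`. Consequently, modulo `[L, [L,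
I]]`, brackets with `I` depend only on classes in `L / [L, L]`, that is, on generators. -/
theorem lie_mem_lie_lie_of_mem_derived (I : LieIdeal k L) {x y : L}
    (hx : x ∈ lowerCentralSeries k L L 1) (hy : y ∈ I) :
    ⁅x, y⁆ ∈ ⁅(⊤ : LieIdeal k L), ⁅(⊤ : LieIdeal k L), I⁆⁆ := by
  rw [LieModule.lowerCentralSeries_succ, LieModule.lowerCentralSeries_zero,
    ← LieSubmodule.mem_toSubmodule, LieSubmodule.lieIdeal_oper_eq_linear_span'] at hx
  refine lie_mem_of_mem_span (T := I)
    (P := LieSubmodule.toSubmodule ⁅(⊤ : LieIdeal k L), ⁅(⊤ : LieIdeal k L), I⁆⁆)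
    ?_ hx (Submodule.subset_span hy)
  rintro _ ⟨a, -, b, -, rfl⟩ c hc
  rw [lie_lie]
  have (u v : L) : ⁅u, ⁅v, c⁆⁆ ∈ ⁅(⊤ : LieIdeal k L), ⁅(⊤ : LieIdeal k L), I⁆⁆ :=
    LieSubmodule.lie_mem_lie (LieSubmodule.mem_top u)
      (LieSubmodule.lie_mem_lie (LieSubmodule.mem_top v) hc)
  exact sub_mem (this a b) (this b a)

/-- If `H 0` generates `L` modulo the derived algebra, then `H i` fills the lower central series
up to the next term. -/
theorem lowerCentralSeries_le_sup (H : ℕ → Submodule k L)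
    (h₀ : H 0 ⊔ (lowerCentralSeries k L L 1).toSubmodule = ⊤)
    (hH : ∀ i, ∀ a ∈ H 0, ∀ b ∈ H i, ⁅a, b⁆ ∈ H (i + 1)) (i : ℕ) :
    (lowerCentralSeries k L L i).toSubmodule ≤
      (H i ⊓ (lowerCentralSeries k L L i).toSubmodule) ⊔
        (lowerCentralSeries k L L (i + 1)).toSubmodule := by
  induction i with
  | zero => simpa using h₀.ge
  | succ i ih =>
    intro z hz
    rw [LieModule.lowerCentralSeries_succ, LieSubmodule.lieIdeal_oper_eq_linear_span'] at hz
    refine Submodule.span_le.2 ?_ hz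
    rintro _ ⟨a, -, b, hb, rfl⟩
    obtain ⟨a₁, ha₁, a₂, ha₂, rfl⟩ := Submodule.mem_sup.1 (h₀.ge (Submodule.mem_top (x := a)))
    obtain ⟨b₁, ⟨hb₁, hb₁'⟩, b₂, hb₂, rfl⟩ := Submodule.mem_sup.1 (ih hb)
    have h₁ : ⁅a₁, b₁⁆ ∈ H (i + 1) ⊓ (lowerCentralSeries k L L (i + 1)).toSubmodule :=
      ⟨hH i _ ha₁ _ hb₁, lie_mem_lowerCentralSeries_succ _ hb₁'⟩
    have h₂ : ⁅a₁, b₂⁆ ∈ lowerCentralSeries k L L (i + 1 + 1) :=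
      lie_mem_lowerCentralSeries_succ _ hb₂
    have h₃ : ⁅a₂, b₁ + b₂⁆ ∈ lowerCentralSeries k L L (i + 1 + 1) := by
      rw [LieModule.lowerCentralSeries_succ, LieModule.lowerCentralSeries_succ]
      exact lie_mem_lie_lie_of_mem_derived _ ha₂ hb
    rw [add_lie, lie_add a₁, add_assoc ⁅a₁, b₁⁆]
    exact Submodule.add_mem_sup h₁ (add_mem h₂ h₃)

theorem lie_mem_lowerCentralSeries_add {i j : ℕ} {a b : L}
    (ha : a ∈ lowerCentralSeries k L L i) (hb : b ∈ lowerCentralSeries k L L j) :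
    ⁅a, b⁆ ∈ lowerCentralSeries k L L (i + j + 1) := by
  induction i generalizing j a b with
  | zero =>
    rw [zero_add]
    exact lie_mem_lowerCentralSeries_succ a hb
  | succ i ih =>
    rw [LieModule.lowerCentralSeries_succ, ← LieSubmodule.mem_toSubmodule,
      LieSubmodule.lieIdeal_oper_eq_linear_span'] at ha
    refine lie_mem_of_mem_span (T := lowerCentralSeries k L L j)
      (P := (lowerCentralSeries k L L (i + 1 + j + 1)).toSubmodule) ?_ ha
      (Submodule.subset_span hb)
    rintro _ ⟨u, -, v, hv, rfl⟩ c hc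
    have h₁ := lie_mem_lowerCentralSeries_succ u (ih hv hc)
    have h₂ := ih hv (lie_mem_lowerCentralSeries_succ u hc)
    rw [lie_lie]
    have e₁ : i + j + 1 + 1 = i + 1 + j + 1 := by omega
    have e₂ : i + (j + 1) + 1 = i + 1 + j + 1 := by omega
    rw [e₁] at h₁
    rw [e₂] at h₂
    exact sub_mem h₁ h₂

theorem IsLieMonomial.mem_lowerCentralSeries {ι : Type w} {x : ι → L} {r : ℕ} {a : L}
    (h : IsLieMonomial x r a) : a ∈ lowerCentralSeries k L L (r - 1) := by
  induction h with
  | gen i => simp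
  | @lie r s a b ha hb iha ihb =>
    have := ha.one_le
    have := hb.one_le
    have h := lie_mem_lowerCentralSeries_add iha ihb
    have e : r - 1 + (s - 1) + 1 = r + s - 1 := by omega
    rwa [e] at h

end LowerCentralSeries

/-! ### The grading of the free Lie algebra by word length -/

section Grading

variable (k : Type u) [Field k] {X : Type v}

/-- The grading of the free algebra by word length, as a map to polynomials. -/
def gradingHom (X : Type v) : FreeAlgebra k X →ₐ[k] Polynomial (FreeAlgebra k X) :=
  FreeAlgebra.lift k fun x => Polynomial.monomial 1 (FreeAlgebra.ι k x)

theorem IsLieMonomial.gradingHom_eq {r : ℕ} {a : FreeLieAlgebra k X}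
    (h : IsLieMonomial (FreeLieAlgebra.of k) r a) :
    gradingHom k X (toFreeAlgebra k X a) = Polynomial.monomial r (toFreeAlgebra k X a) := by
  induction h with
  | gen x => simp [gradingHom]
  | @lie r s a b _ _ ha hb =>
    rw [LieHom.map_lie, Ring.lie_def, map_sub, map_mul, map_mul, ha, hb,
      Polynomial.monomial_mul_monomial, Polynomial.monomial_mul_monomial, add_comm s r, map_sub]

theorem gradingHom_eq_of_mem_span {r : ℕ} {a : FreeLieAlgebra k X}
    (h : a ∈ Submodule.span k {a | IsLieMonomial (FreeLieAlgebra.of k) r a}) :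
    gradingHom k X (toFreeAlgebra k X a) = Polynomial.monomial r (toFreeAlgebra k X a) := by
  induction h using Submodule.span_induction with
  | mem a h => exact h.gradingHom_eq k
  | zero => simp
  | add a b _ _ ha hb => simp [ha, hb]
  | smul c a _ ha => rw [map_smul, map_smul, ha, Polynomial.smul_monomial]

/-- The elements of the free Lie algebra all of whose words have length at least `n`. -/
def wordFiltration (X : Type v) (n : ℕ) : Submodule k (FreeLieAlgebra k X) where
  carrier := {z | Polynomial.X ^ n ∣ gradingHom k X (toFreeAlgebra k X z)}
  zero_mem' := by simp
  add_mem' {a b} ha hb := by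
    change Polynomial.X ^ n ∣ gradingHom k X (toFreeAlgebra k X (a + b))
    rw [map_add, map_add]
    exact dvd_add ha hb
  smul_mem' c a ha := by
    change Polynomial.X ^ n ∣ gradingHom k X (toFreeAlgebra k X (c • a))
    rw [map_smul, map_smul, Algebra.smul_def, Algebra.commutes]
    exact Dvd.dvd.mul_right ha _

variable {k} in
theorem mem_wordFiltration_iff {n : ℕ} {z : FreeLieAlgebra k X} : z ∈ wordFiltration k X n ↔
    Polynomial.X ^ n ∣ gradingHom k X (toFreeAlgebra k X z) := Iff.rfl

theorem mem_wordFiltration_one (z : FreeLieAlgebra k X) : z ∈ wordFiltration k X 1 := by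
  obtain ⟨s, hz⟩ := exists_mem_monomialSpan k z
  refine Submodule.span_le.2 ?_ hz
  rintro a ⟨r, -, h⟩
  have := h.one_le
  rw [SetLike.mem_coe, mem_wordFiltration_iff, h.gradingHom_eq, pow_one, Polynomial.X_dvd_iff,
    Polynomial.coeff_monomial,
    if_neg (by omega)]

theorem mem_wordFiltration {i : ℕ} {z : FreeLieAlgebra k X}
    (hz : z ∈ lowerCentralSeries k (FreeLieAlgebra k X) (FreeLieAlgebra k X) i) :
    z ∈ wordFiltration k X (i + 1) := by
  induction i generalizing z with
  | zero => exact mem_wordFiltration_one k z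
  | succ i ih =>
    rw [LieModule.lowerCentralSeries_succ, ← LieSubmodule.mem_toSubmodule,
      LieSubmodule.lieIdeal_oper_eq_linear_span'] at hz
    refine Submodule.span_le.2 ?_ hz
    rintro _ ⟨a, -, b, hb, rfl⟩
    obtain ⟨a', ha'⟩ := mem_wordFiltration_one k a
    obtain ⟨b', hb'⟩ := ih hb
    rw [pow_one] at ha'
    rw [SetLike.mem_coe, mem_wordFiltration_iff, LieHom.map_lie, Ring.lie_def,
      map_sub, map_mul, map_mul, ha', hb']
    refine dvd_sub ⟨a' * b', ?_⟩ ⟨b' * a', ?_⟩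
    · rw [pow_succ' _ (i + 1), mul_assoc, ← mul_assoc a', ← Polynomial.X_pow_mul, mul_assoc,
        mul_assoc]
    · rw [pow_succ _ (i + 1), mul_assoc, ← mul_assoc b', ← Polynomial.X_mul, mul_assoc,
        mul_assoc]

/-- All words of `z` have length `r`, yet membership in the series forces length at least `r + 1`;
the embedding turns this into `z = 0`. -/
theorem eq_zero_of_mem_span_of_mem_lowerCentralSeries {r : ℕ} {z : FreeLieAlgebra k X}
    (h : z ∈ Submodule.span k {a | IsLieMonomial (FreeLieAlgebra.of k) r a})
    (h' : z ∈ lowerCentralSeries k (FreeLieAlgebra k X) (FreeLieAlgebra k X) r) : z = 0 := by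
  have h₁ := mem_wordFiltration_iff.1 (mem_wordFiltration k h')
  rw [gradingHom_eq_of_mem_span k h, Polynomial.X_pow_dvd_iff] at h₁
  have h₂ := h₁ r (Nat.lt_succ_self r)
  rw [Polynomial.coeff_monomial_same] at h₂
  exact toFreeAlgebra_injective k (h₂.trans (map_zero _).symm)

theorem span_generators_sup_lowerCentralSeries :
    Submodule.span k {a : FreeLieAlgebra k X | IsLieMonomial (FreeLieAlgebra.of k) 1 a} ⊔
      (lowerCentralSeries k (FreeLieAlgebra k X) (FreeLieAlgebra k X) 1).toSubmodule = ⊤ := by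
  rw [eq_top_iff]
  intro z _
  obtain ⟨s, hz⟩ := exists_mem_monomialSpan k z
  refine Submodule.span_le.2 ?_ hz
  rintro a ⟨r, -, h⟩
  induction h with
  | gen x => exact Submodule.mem_sup_left (Submodule.subset_span (.gen x))
  | lie _ _ _ _ =>
    exact Submodule.mem_sup_right (lie_mem_lowerCentralSeries_succ _ (by simp))

theorem lowerCentralSeries_freeLieAlgebra_le (i : ℕ) :
    (lowerCentralSeries k (FreeLieAlgebra k X) (FreeLieAlgebra k X) i).toSubmodule ≤
      (Submodule.span k {a | IsLieMonomial (FreeLieAlgebra.of k) (i + 1) a} ⊓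
        (lowerCentralSeries k (FreeLieAlgebra k X) (FreeLieAlgebra k X) i).toSubmodule) ⊔
        (lowerCentralSeries k (FreeLieAlgebra k X) (FreeLieAlgebra k X) (i + 1)).toSubmodule := by
  refine lowerCentralSeries_le_sup
    (fun i => Submodule.span k {a | IsLieMonomial (FreeLieAlgebra.of k) (i + 1) a})
    (span_generators_sup_lowerCentralSeries k) ?_ i
  intro i a ha b hb
  refine lie_mem_of_mem_span ?_ ha hb
  intro a ha b hb
  have := ha.lie hb
  rw [zero_add, add_comm] at this
  exact Submodule.subset_span this

end Grading

/-! ### Centralizers of generators -/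

section Centralizer

variable (k : Type u) [Field k] {X : Type v}

/-- Comparing coefficients in `x a = a x` moves a trailing `x` of a word to its front. Once the word
ends in `z ≠ x`, it cannot occur in `a x`. So `a` involves only powers of `x`. -/
theorem coeff_eq_zero_of_commute {x z : X} (hz : z ≠ x) {a : MonoidAlgebra k (FreeMonoid X)}
    (h : MonoidAlgebra.single (FreeMonoid.of x) 1 * a =
      a * MonoidAlgebra.single (FreeMonoid.of x) 1) (j : ℕ) (u : FreeMonoid X) :
    a.coeff (u * FreeMonoid.of z * FreeMonoid.of x ^ j) = 0 := by
  induction j generalizing u with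
  | zero =>
    have h₁ := congrArg (fun b => b.coeff (FreeMonoid.of x * (u * FreeMonoid.of z))) h
    rw [MonoidAlgebra.coeff_single_mul_mul, MonoidAlgebra.coeff_mul_single_of_forall_mul_ne,
      one_mul] at h₁
    · simpa using h₁
    · intro d hd
      rw [← mul_assoc] at hd
      have := (List.append_inj' (FreeMonoid.toList.congr_arg hd) rfl).2
      simp at this
      exact hz this.symm
  | succ j ih =>
    have h₁ := congrArg (fun b => b.coeff
      (FreeMonoid.of x * (u * FreeMonoid.of z * FreeMonoid.of x ^ j) * FreeMonoid.of x)) h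
    rw [MonoidAlgebra.coeff_mul_single_mul, mul_assoc, MonoidAlgebra.coeff_single_mul_mul,
      one_mul, mul_one, ← mul_assoc, ← mul_assoc, ih] at h₁
    rwa [pow_succ, ← mul_assoc]

open Classical in
/-- The substitution that keeps the generator `x` and sends the other ones to zero. -/
def singleVariableHom (x : X) : FreeAlgebra k X →ₐ[k] Polynomial k :=
  FreeAlgebra.lift k fun y => if y = x then Polynomial.X else 0

theorem exists_eq_pow_or_exists_mul (x : X) (w : FreeMonoid X) :
    (∃ j, w = FreeMonoid.of x ^ j) ∨
      ∃ u z j, z ≠ x ∧ w = u * FreeMonoid.of z * FreeMonoid.of x ^ j := by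
  induction w using FreeMonoid.inductionOn' with
  | one => exact .inl ⟨0, (pow_zero _).symm⟩
  | of_mul y w ih =>
    rcases ih with ⟨j, rfl⟩ | ⟨u, z, j, hz, rfl⟩
    · by_cases hy : y = x
      · exact .inl ⟨j + 1, by rw [hy, pow_succ']⟩
      · exact .inr ⟨1, y, j, hy, by rw [one_mul]⟩
    · exact .inr ⟨FreeMonoid.of y * u, z, j, hz, by simp only [mul_assoc]⟩

theorem coeff_singleVariableHom (x : X) (a : FreeAlgebra k X) (j : ℕ) :
    (singleVariableHom k x a).coeff j =
      (FreeAlgebra.equivMonoidAlgebraFreeMonoid a).coeff (FreeMonoid.of x ^ j) := by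
  classical
  obtain ⟨a, rfl⟩ := FreeAlgebra.equivMonoidAlgebraFreeMonoid.symm.surjective a
  rw [AlgEquiv.apply_symm_apply]
  induction a using MonoidAlgebra.induction_linear with
  | zero => simp
  | add a b ha hb => simp [ha, hb]
  | single w c =>
    have h₁ (w : FreeMonoid X) : FreeAlgebra.equivMonoidAlgebraFreeMonoid.symm
        (MonoidAlgebra.single w c) = c • FreeMonoid.lift (FreeAlgebra.ι k) w := by
      simp [FreeAlgebra.equivMonoidAlgebraFreeMonoid]
    have length_pow (i : ℕ) : (FreeMonoid.of x ^ i).length = i := by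
      induction i with
      | zero => rfl
      | succ i ih => rw [pow_succ, FreeMonoid.length_mul, ih, FreeMonoid.length_of]
    rw [h₁, map_smul, Polynomial.coeff_smul, MonoidAlgebra.coeff_single, Finsupp.single_apply]
    rcases exists_eq_pow_or_exists_mul x w with ⟨i, rfl⟩ | ⟨u, z, i, hz, rfl⟩
    · have : (FreeMonoid.of x ^ i = FreeMonoid.of x ^ j) ↔ i = j :=
        ⟨fun h => by simpa [length_pow] using congrArg FreeMonoid.length h, fun h => by rw [h]⟩
      simp [singleVariableHom, Polynomial.coeff_X_pow, this, eq_comm]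
    · have : u * FreeMonoid.of z * FreeMonoid.of x ^ i ≠ FreeMonoid.of x ^ j := by
        intro h
        -- A homomorphism to multiplicative `ℕ`: it is `1` on powers of `x` and `0` on words with
        -- another letter.
        have h := congrArg (FreeMonoid.lift fun y => if y = x then (1 : ℕ) else 0) h
        simp [hz] at h
      simp [singleVariableHom, this, hz]

/-- The target is commutative, so commutators vanish; this removes the powers of `x` left by
`coeff_eq_zero_of_commute`. -/
theorem singleVariableHom_eq_zero (x : X) {z : FreeLieAlgebra k X}
    (hz : z ∈ lowerCentralSeries k (FreeLieAlgebra k X) (FreeLieAlgebra k X) 1) :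
    singleVariableHom k x (toFreeAlgebra k X z) = 0 := by
  rw [LieModule.lowerCentralSeries_succ, ← LieSubmodule.mem_toSubmodule,
      LieSubmodule.lieIdeal_oper_eq_linear_span'] at hz
  induction hz using Submodule.span_induction with
  | mem _ h =>
    obtain ⟨a, -, b, -, rfl⟩ := h
    rw [LieHom.map_lie, Ring.lie_def, map_sub, map_mul, map_mul, mul_comm, sub_self]
  | zero => simp
  | add a b _ _ ha hb => simp [ha, hb]
  | smul c a _ ha => simp [ha]

/-- In a free Lie algebra, no nonzero element of the derived algebra commutes with a generator. -/
theorem eq_zero_of_lie_of_eq_zero (x : X) {z : FreeLieAlgebra k X}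
    (hz : z ∈ lowerCentralSeries k (FreeLieAlgebra k X) (FreeLieAlgebra k X) 1)
    (h : ⁅FreeLieAlgebra.of k x, z⁆ = 0) : z = 0 := by
  apply toFreeAlgebra_injective k
  rw [map_zero]
  apply FreeAlgebra.equivMonoidAlgebraFreeMonoid.injective
  rw [map_zero]
  have h₁ := congrArg (fun a => FreeAlgebra.equivMonoidAlgebraFreeMonoid (toFreeAlgebra k X a)) h
  simp only [LieHom.map_lie, Ring.lie_def, toFreeAlgebra_of, map_sub, map_mul, map_zero,
    sub_eq_zero] at h₁
  have h₂ : FreeAlgebra.equivMonoidAlgebraFreeMonoid (FreeAlgebra.ι k x) =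
      MonoidAlgebra.single (FreeMonoid.of x) 1 := by
    simp [FreeAlgebra.equivMonoidAlgebraFreeMonoid]
  rw [h₂] at h₁
  ext w
  rcases exists_eq_pow_or_exists_mul x w with ⟨j, rfl⟩ | ⟨u, y, j, hy, rfl⟩
  · rw [← coeff_singleVariableHom, singleVariableHom_eq_zero k x hz]
    simp
  · rw [coeff_eq_zero_of_commute k hy h₁]
    simp

/-- Graded form of the injectivity of `ad x`: the leading part `a` of `z` has `⁅x, a⁆` homogeneous
of degree `i + 2` and in a deeper term, hence zero. The bound `1 ≤ i` puts `a` in the derived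
algebra. -/
theorem mem_lowerCentralSeries_of_lie_of_mem (x : X) {i : ℕ} (hi : 1 ≤ i) {z : FreeLieAlgebra k X}
    (hz : z ∈ lowerCentralSeries k (FreeLieAlgebra k X) (FreeLieAlgebra k X) i)
    (h : ⁅FreeLieAlgebra.of k x, z⁆ ∈
      lowerCentralSeries k (FreeLieAlgebra k X) (FreeLieAlgebra k X) (i + 2)) :
    z ∈ lowerCentralSeries k (FreeLieAlgebra k X) (FreeLieAlgebra k X) (i + 1) := by
  obtain ⟨a, ⟨ha, ha'⟩, b, hb, rfl⟩ :=
    Submodule.mem_sup.1 (lowerCentralSeries_freeLieAlgebra_le k i hz)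
  have h₁ : ⁅FreeLieAlgebra.of k x, a⁆ = 0 := by
    refine eq_zero_of_mem_span_of_mem_lowerCentralSeries k (r := i + 2) ?_ ?_
    · refine lie_mem_of_mem_span (S := {FreeLieAlgebra.of k x}) ?_
        (Submodule.mem_span_singleton_self _) ha
      rintro _ rfl b hb
      have := (IsLieMonomial.gen (x := FreeLieAlgebra.of k) x).lie hb
      rw [add_comm] at this
      exact Submodule.subset_span this
    · have := sub_mem h (lie_mem_lowerCentralSeries_succ (FreeLieAlgebra.of k x) hb)
      rwa [lie_add, add_sub_cancel_right] at this
  rw [eq_zero_of_lie_of_eq_zero k x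
    (LieModule.antitone_lowerCentralSeries k _ _ hi ha') h₁, zero_add]
  exact hb

end Centralizer

/-! ### Hopf's formula -/

section Hopf

open LieModule.Cohomology

variable {k : Type u} [Field k] {Q : Type v} [LieRing Q] [LieAlgebra k Q]
  {g : Type w} [LieRing g] [LieAlgebra k g]

/-- Changing an argument by an element of the kernel changes the bracket by an element of `[Q, ker
φ]`. So `f ⁅·, ·⁆` descends to `g`. -/
theorem apply_lie_eq_of_mem_dualAnnihilator (φ : Q →ₗ⁅k⁆ g) {f : Module.Dual k Q}
    (hf : f ∈ (⁅(⊤ : LieIdeal k Q), φ.ker⁆).toSubmodule.dualAnnihilator) {a a' b b' : Q}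
    (ha : φ a = φ a') (hb : φ b = φ b') : f ⁅a, b⁆ = f ⁅a', b'⁆ := by
  rw [Submodule.mem_dualAnnihilator] at hf
  have key (c d : Q) (hd : φ d = 0) : f ⁅c, d⁆ = 0 :=
    hf _ (LieSubmodule.lie_mem_lie (LieSubmodule.mem_top c) (LieHom.mem_ker.2 hd))
  have h₁ := key a (b - b') (by rw [map_sub, hb, sub_self])
  have h₂ := key b' (a - a') (by rw [map_sub, ha, sub_self])
  rw [lie_sub, map_sub, sub_eq_zero] at h₁
  rw [lie_sub, map_sub, sub_eq_zero, ← lie_skew, ← lie_skew b' a', map_neg, map_neg,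
    neg_inj] at h₂
  rw [h₁, h₂]

/-- For a linear section `s` of `φ`, the 2-cocycle `(x, y) ↦ f ⁅s x, s y⁆` attached to a linear
form `f` that vanishes on the brackets with the kernel of `φ`. -/
def cocycleOfForm (φ : Q →ₗ⁅k⁆ g) (s : g →ₗ[k] Q) (hs : ∀ x, φ (s x) = x) :
    (⁅(⊤ : LieIdeal k Q), φ.ker⁆).toSubmodule.dualAnnihilator →ₗ[k]
      twoCocycle k g (TrivialLieModule k g k) where
  toFun f := ⟨⟨LinearMap.mk₂ k
      (fun x y => (TrivialLieModule.equiv k g k).symm (f.1 ⁅s x, s y⁆))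
      (fun x x' y => by simp) (fun c x y => by rw [map_smul, smul_lie, map_smul, map_smul])
      (fun x y y' => by simp)
      (fun c x y => by rw [map_smul, lie_smul, map_smul, map_smul]), fun x => by simp⟩, by
    rw [mem_twoCocycle_iff_of_trivial]
    intro x y z
    change (TrivialLieModule.equiv k g k).symm (f.1 ⁅s x, s ⁅y, z⁆⁆) =
      (TrivialLieModule.equiv k g k).symm (f.1 ⁅s ⁅x, y⁆, s z⁆) +
      (TrivialLieModule.equiv k g k).symm (f.1 ⁅s y, s ⁅x, z⁆⁆)
    have h (u v : g) : φ (s ⁅u, v⁆) = φ ⁅s u, s v⁆ := by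
      rw [hs, LieHom.map_lie, hs, hs]
    rw [apply_lie_eq_of_mem_dualAnnihilator φ f.2 rfl (h y z),
      apply_lie_eq_of_mem_dualAnnihilator φ f.2 (h x y) rfl,
      apply_lie_eq_of_mem_dualAnnihilator φ f.2 rfl (h x z), leibniz_lie, map_add, map_add]⟩
  map_add' f f' := by
    ext x y
    rfl
  map_smul' c f := by
    ext x y
    rfl

theorem cocycleOfForm_apply (φ : Q →ₗ⁅k⁆ g) (s : g →ₗ[k] Q) (hs : ∀ x, φ (s x) = x)
    (f : (⁅(⊤ : LieIdeal k Q), φ.ker⁆).toSubmodule.dualAnnihilator) (a b : Q) :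
    (cocycleOfForm φ s hs f).1 (φ a) (φ b) = (TrivialLieModule.equiv k g k).symm (f.1 ⁅a, b⁆) := by
  change (TrivialLieModule.equiv k g k).symm (f.1 ⁅s (φ a), s (φ b)⁆) = _
  rw [apply_lie_eq_of_mem_dualAnnihilator φ f.2 (hs (φ a)) (hs (φ b))]

/-- Hopf's formula for the second Betti number, for a finite-dimensional covering algebra on which
all 2-cocycles of the quotient split. -/
theorem b2_add_finrank_lie_ker [FiniteDimensional k Q] (φ : Q →ₗ⁅k⁆ g)
    (hφ : Function.Surjective φ) (hker : φ.ker ≤ lowerCentralSeries k Q Q 1)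
    (hsplit : ∀ ω : twoCocycle k g (TrivialLieModule k g k), ∃ f : Module.Dual k Q,
      ∀ a b, (TrivialLieModule.equiv k g k).symm (f ⁅a, b⁆) = ω.1 (φ a) (φ b)) :
    b2 k g + Module.finrank k (⁅(⊤ : LieIdeal k Q), φ.ker⁆).toSubmodule =
      Module.finrank k φ.ker.toSubmodule := by
  obtain ⟨s, hs⟩ := (φ : Q →ₗ[k] g).exists_rightInverse_of_surjective
    (LinearMap.range_eq_top.2 hφ)
  have hs (x : g) : φ (s x) = x := congrArg (fun h => h x) hs
  let T : (⁅(⊤ : LieIdeal k Q), φ.ker⁆).toSubmodule.dualAnnihilator →ₗ[k] H2 k g :=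
    (twoCoboundary k g).mkQ ∘ₗ cocycleOfForm φ s hs
  have hT : Function.Surjective T := by
    intro ω
    obtain ⟨ω, rfl⟩ := (twoCoboundary k g).mkQ_surjective ω
    obtain ⟨f, hf⟩ := hsplit ω
    have hf' : f ∈ (⁅(⊤ : LieIdeal k Q), φ.ker⁆).toSubmodule.dualAnnihilator := by
      rw [Submodule.mem_dualAnnihilator]
      intro z hz
      rw [LieSubmodule.lieIdeal_oper_eq_linear_span'] at hz
      refine (Submodule.span_le (p := LinearMap.ker f)).2 ?_ hz
      rintro _ ⟨a, -, b, hb, rfl⟩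
      apply (TrivialLieModule.equiv k g k).symm.injective
      rw [hf, LieHom.mem_ker.1 hb, map_zero, map_zero]
    refine ⟨⟨f, hf'⟩, congrArg (twoCoboundary k g).mkQ ?_⟩
    apply Subtype.ext
    apply Subtype.ext
    ext x y
    obtain ⟨a, rfl⟩ := hφ x
    obtain ⟨b, rfl⟩ := hφ y
    exact (cocycleOfForm_apply φ s hs _ a b).trans (hf a b)
  -- The cocycle of `f` is a coboundary exactly when `f` vanishes on `ker φ`, so `H2` is the
  -- quotient of the annihilator of `[Q, ker φ]` by that of `ker φ`.
  have hTker : LinearMap.ker T =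
      φ.ker.toSubmodule.dualAnnihilator.submoduleOf _ := by
    ext f
    rw [LinearMap.mem_ker, LinearMap.comp_apply, Submodule.mkQ_apply, Submodule.Quotient.mk_eq_zero,
      Submodule.submoduleOf, Submodule.mem_comap, Submodule.subtype_apply,
      Submodule.mem_dualAnnihilator]
    constructor
    · rintro ⟨η, hη⟩ z hz
      -- If the cocycle is the coboundary of `η`, then `f + η ∘ φ` kills all brackets, hence `ker
      -- φ`, where it agrees with `f`.
      have h₁ : (lowerCentralSeries k Q Q 1).toSubmodule ≤ LinearMap.ker (f.1 +
          (TrivialLieModule.equiv k g k).toLinearMap ∘ₗ η ∘ₗ (φ : Q →ₗ[k] g)) := by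
        intro z hz
        rw [LieModule.lowerCentralSeries_succ,
          LieSubmodule.lieIdeal_oper_eq_linear_span'] at hz
        refine Submodule.span_le.2 ?_ hz
        rintro _ ⟨a, -, b, -, rfl⟩
        have h := (congrArg (fun c : twoCochain k g (TrivialLieModule k g k) => c (φ a) (φ b))
          hη).trans (cocycleOfForm_apply φ s hs f a b)
        rw [d₁₂_apply_apply_ofTrivial] at h
        change f.1 ⁅a, b⁆ + TrivialLieModule.equiv k g k (η (φ ⁅a, b⁆)) = 0
        rw [neg_eq_iff_eq_neg] at h
        rw [LieHom.map_lie, h, map_neg, LinearEquiv.apply_symm_apply, add_neg_cancel]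
      have h₂ := h₁ (hker hz)
      have hz' : φ z = 0 := hz
      simpa [hz'] using h₂
    · intro hf
      let η : g →ₗ[k] TrivialLieModule k g k :=
        -((TrivialLieModule.equiv k g k).symm.toLinearMap ∘ₗ f.1 ∘ₗ s)
      refine ⟨η, ?_⟩
      apply Subtype.ext
      ext x y
      obtain ⟨a, rfl⟩ := hφ x
      obtain ⟨b, rfl⟩ := hφ y
      refine (d₁₂_apply_apply_ofTrivial _ _ _ η (φ a) (φ b)).trans
        (Eq.trans ?_ (cocycleOfForm_apply φ s hs f a b).symm)
      change - -(TrivialLieModule.equiv k g k).symm (f.1 (s ⁅φ a, φ b⁆)) = _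
      rw [neg_neg]
      have h := hf (s ⁅φ a, φ b⁆ - ⁅a, b⁆) (by
        rw [LieSubmodule.mem_toSubmodule, LieHom.mem_ker, map_sub, hs, LieHom.map_lie, sub_self])
      rw [map_sub, sub_eq_zero] at h
      rw [h]
  have h₁ := LinearMap.finrank_range_add_finrank_ker T
  rw [LinearMap.range_eq_top.2 hT, finrank_top, hTker] at h₁
  have h₂ : Module.finrank k (φ.ker.toSubmodule.dualAnnihilator.submoduleOf
      (⁅(⊤ : LieIdeal k Q), φ.ker⁆).toSubmodule.dualAnnihilator) =
      Module.finrank k φ.ker.toSubmodule.dualAnnihilator :=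
    (Submodule.submoduleOfEquivOfLe (Submodule.dualAnnihilator_anti
      (LieSubmodule.lie_le_right φ.ker ⊤))).finrank_eq
  have h₃ := Subspace.finrank_add_finrank_dualAnnihilator_eq φ.ker.toSubmodule
  have h₄ := Subspace.finrank_add_finrank_dualAnnihilator_eq
    (⁅(⊤ : LieIdeal k Q), φ.ker⁆).toSubmodule
  change b2 k g + _ = _ at h₁
  omega

end Hopf

/-! ### Splitting of cocycles over a free Lie algebra -/

section Splitting

open LieModule.Cohomology LieAlgebra

variable {k : Type u} [Field k] {X : Type v} {g : Type w} [LieRing g] [LieAlgebra k g]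

/-- By freeness `φ` lifts to the central extension of `g` defined by `ω`; the form is the central
coordinate of the lift. -/
theorem exists_form_freeLieAlgebra (φ : FreeLieAlgebra k X →ₗ⁅k⁆ g)
    (ω : twoCocycle k g (TrivialLieModule k g k)) : ∃ f : Module.Dual k (FreeLieAlgebra k X),
      ∀ a b, (TrivialLieModule.equiv k g k).symm (f ⁅a, b⁆) = ω.1 (φ a) (φ b) := by
  let ψ : FreeLieAlgebra k X →ₗ⁅k⁆ ofTwoCocycle ω :=
    FreeLieAlgebra.lift k fun x => ofProd ω (φ (FreeLieAlgebra.of k x), 0)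
  let p₁ : ofTwoCocycle ω →ₗ⁅k⁆ g :=
    { toFun x := ((ofProd ω).symm x).1
      map_add' _ _ := rfl
      map_smul' _ _ := rfl
      map_lie' := rfl }
  let p₂ : ofTwoCocycle ω →ₗ[k] TrivialLieModule k g k :=
    { toFun x := ((ofProd ω).symm x).2
      map_add' _ _ := rfl
      map_smul' _ _ := rfl }
  have h : p₁.comp ψ = φ := by
    ext x
    rw [LieHom.comp_apply, FreeLieAlgebra.lift_of_apply]
    rfl
  refine ⟨(TrivialLieModule.equiv k g k).toLinearMap ∘ₗ p₂ ∘ₗ (ψ : _ →ₗ[k] ofTwoCocycle ω),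
    fun a b => ?_⟩
  have ha : p₁ (ψ a) = φ a := congrArg (fun f => f a) h
  have hb : p₁ (ψ b) = φ b := congrArg (fun f => f b) h
  change p₂ (ψ ⁅a, b⁆) = _
  rw [LieHom.map_lie, ← ha, ← hb, bracket_ofTwoCocycle]
  change ω.1 (p₁ (ψ a)) (p₁ (ψ b)) + ⁅p₁ (ψ a), p₂ (ψ b)⁆ - ⁅p₁ (ψ b), p₂ (ψ a)⁆ = _
  rw [trivial_lie_zero, trivial_lie_zero, add_zero, sub_zero]

end Splitting

end NilpotentBetti

end

noncomputable section

namespace NilpotentBetti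

universe u v w

open LieModule (lowerCentralSeries)
open Module (finrank)

/-! ### Finite dimension from finitely many generators -/

section FiniteDimensional

variable {k : Type u} [Field k] {L : Type v} [LieRing L] [LieAlgebra k L]

theorem finiteDimensional_of_generators (V : Submodule k L) [FiniteDimensional k V]
    (hV : V ⊔ (lowerCentralSeries k L L 1).toSubmodule = ⊤) {q : ℕ}
    (hq : lowerCentralSeries k L L q = ⊥) : FiniteDimensional k L := by
  -- `H i` is spanned by the right-normed brackets of `i + 1` elements of `V`; it covers the `i`-th
  -- lower central quotient.
  let H : ℕ → Submodule k L := fun i => Nat.rec V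
    (fun _ W => Submodule.map₂ (LieModule.toEnd k L L : L →ₗ[k] Module.End k L) V W) i
  have hH (i : ℕ) : (H i).FG := by
    induction i with
    | zero => exact Module.Finite.iff_fg.1 ‹_›
    | succ i ih => exact Submodule.FG.map₂ _ (Module.Finite.iff_fg.1 ‹_›) ih
  have key (i : ℕ) : ∃ W : Submodule k L, W.FG ∧
      W ⊔ (lowerCentralSeries k L L i).toSubmodule = ⊤ := by
    induction i with
    | zero => exact ⟨⊥, Submodule.fg_bot, by simp⟩
    | succ i ih =>
      obtain ⟨W, hW, h⟩ := ih
      refine ⟨W ⊔ H i, hW.sup (hH i), ?_⟩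
      rw [eq_top_iff, ← h, sup_assoc]
      refine sup_le_sup_left ((lowerCentralSeries_le_sup H hV
        (fun i a ha b hb => Submodule.apply_mem_map₂ _ ha hb) i).trans
        (sup_le_sup_right inf_le_left _)) _
  obtain ⟨W, hW, h⟩ := key q
  rw [hq, LieSubmodule.bot_toSubmodule, sup_bot_eq] at h
  exact ⟨h ▸ hW⟩

end FiniteDimensional

section Monomials

variable {k : Type u} [Field k] {L : Type v} {L' : Type w} [LieRing L] [LieAlgebra k L]
  [LieRing L'] [LieAlgebra k L']

theorem IsLieMonomial.map {ι : Type*} {x : ι → L} {r : ℕ} {a : L} (h : IsLieMonomial x r a)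
    (φ : L →ₗ⁅k⁆ L') : IsLieMonomial (fun i => φ (x i)) r (φ a) := by
  induction h with
  | gen i => exact .gen i
  | lie _ _ ha hb =>
    rw [LieHom.map_lie]
    exact ha.lie hb

theorem IsLieMonomial.exists_of_map {ι : Type*} {x : ι → L} (φ : L →ₗ⁅k⁆ L') {r : ℕ} {a : L'}
    (h : IsLieMonomial (fun i => φ (x i)) r a) : ∃ b, IsLieMonomial x r b ∧ φ b = a := by
  induction h with
  | gen i => exact ⟨x i, .gen i, rfl⟩
  | lie _ _ ha hb =>
    obtain ⟨a, ha, rfl⟩ := ha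
    obtain ⟨b, hb, rfl⟩ := hb
    exact ⟨⁅a, b⁆, ha.lie hb, LieHom.map_lie φ a b⟩

theorem span_isLieMonomial_map {ι : Type*} (x : ι → L) (φ : L →ₗ⁅k⁆ L') (r : ℕ) :
    (Submodule.span k {a | IsLieMonomial x r a}).map (φ : L →ₗ[k] L') =
      Submodule.span k {a | IsLieMonomial (fun i => φ (x i)) r a} := by
  rw [Submodule.map_span]
  congr 1
  ext a
  exact ⟨fun ⟨b, hb, h⟩ => h ▸ hb.map φ, fun h => h.exists_of_map φ⟩

end Monomials

/-! ### Free nilpotent Lie algebras and their second Betti numbers -/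

namespace FreeNilpotent

variable (k : Type u) [Field k] (n p q : ℕ)

/-- The quotient map from the free Lie algebra. -/
def mkHom : FreeLieAlgebra k (Fin n) →ₗ⁅k⁆ FreeNilpotent k n p :=
  { (lcsTerm k (FreeLieAlgebra k (Fin n)) (p + 1)).toSubmodule.mkQ with
    map_lie' := rfl }

theorem mkHom_surjective : Function.Surjective (mkHom k n p) :=
  Submodule.mkQ_surjective _

theorem mkHom_of (i : Fin n) : mkHom k n p (FreeLieAlgebra.of k i) = gen k n p i := rfl

variable {k n p q}

theorem mkHom_eq_zero_iff {a : FreeLieAlgebra k (Fin n)} : mkHom k n p a = 0 ↔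
    a ∈ lowerCentralSeries k (FreeLieAlgebra k (Fin n)) (FreeLieAlgebra k (Fin n)) p :=
  Submodule.Quotient.mk_eq_zero _

theorem mkHom_mem_iff {i : ℕ} (hi : i ≤ p) {a : FreeLieAlgebra k (Fin n)} :
    mkHom k n p a ∈ lowerCentralSeries k (FreeNilpotent k n p) (FreeNilpotent k n p) i ↔
      a ∈ lowerCentralSeries k (FreeLieAlgebra k (Fin n)) (FreeLieAlgebra k (Fin n)) i := by
  constructor
  · intro h
    rw [← LieIdeal.lowerCentralSeries_map_eq i (mkHom_surjective k n p)] at h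
    obtain ⟨⟨b, hb⟩, hab⟩ := LieIdeal.mem_map_of_surjective (mkHom_surjective k n p) h
    have h₁ : mkHom k n p (a - b) = 0 := by
      rw [map_sub, sub_eq_zero]
      exact hab.symm
    have h₂ := LieModule.antitone_lowerCentralSeries k _ _ hi (mkHom_eq_zero_iff.1 h₁)
    simpa using add_mem h₂ hb
  · exact fun h => LieIdeal.map_lowerCentralSeries_le i (LieIdeal.mem_map h)

theorem lowerCentralSeries_eq_bot :
    lowerCentralSeries k (FreeNilpotent k n p) (FreeNilpotent k n p) p = ⊥ := by
  rw [eq_bot_iff]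
  intro x hx
  obtain ⟨a, rfl⟩ := mkHom_surjective k n p x
  rw [LieSubmodule.mem_bot, mkHom_eq_zero_iff]
  exact (mkHom_mem_iff le_rfl).1 hx

/-- The extension of a map on the free Lie algebra to the free nilpotent quotient. -/
def liftHom {g : Type v} [LieRing g] [LieAlgebra k g] (φ : FreeLieAlgebra k (Fin n) →ₗ⁅k⁆ g)
    (h : lowerCentralSeries k g g p = ⊥) : FreeNilpotent k n p →ₗ⁅k⁆ g :=
  { (lcsTerm k (FreeLieAlgebra k (Fin n)) (p + 1)).toSubmodule.liftQ (φ : _ →ₗ[k] g) (by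
      intro a ha
      have := LieIdeal.map_lowerCentralSeries_le p (LieIdeal.mem_map (f := φ) ha)
      rwa [h, LieSubmodule.mem_bot] at this) with
    map_lie' := by
      intro x y
      obtain ⟨a, rfl⟩ := mkHom_surjective k n p x
      obtain ⟨b, rfl⟩ := mkHom_surjective k n p y
      exact LieHom.map_lie φ a b }

theorem liftHom_mkHom {g : Type v} [LieRing g] [LieAlgebra k g]
    (φ : FreeLieAlgebra k (Fin n) →ₗ⁅k⁆ g) (h : lowerCentralSeries k g g p = ⊥)
    (a : FreeLieAlgebra k (Fin n)) : liftHom φ h (mkHom k n p a) = φ a := rfl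

/-- The projection from the free `p`-step to the free `q`-step nilpotent Lie algebra. -/
def proj (h : q ≤ p) : FreeNilpotent k n p →ₗ⁅k⁆ FreeNilpotent k n q :=
  liftHom (mkHom k n q) (eq_bot_iff.2 ((LieModule.antitone_lowerCentralSeries k _ _ h).trans
    lowerCentralSeries_eq_bot.le))

theorem proj_mkHom (h : q ≤ p) (a : FreeLieAlgebra k (Fin n)) :
    proj h (mkHom k n p a) = mkHom k n q a := rfl

theorem proj_surjective (h : q ≤ p) : Function.Surjective (proj (k := k) (n := n) h) := by
  intro y
  obtain ⟨a, rfl⟩ := mkHom_surjective k n q y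
  exact ⟨mkHom k n p a, rfl⟩

theorem proj_mem_iff (h : q ≤ p) {i : ℕ} (hi : i ≤ q) {x : FreeNilpotent k n p} :
    proj h x ∈ lowerCentralSeries k (FreeNilpotent k n q) (FreeNilpotent k n q) i ↔
      x ∈ lowerCentralSeries k (FreeNilpotent k n p) (FreeNilpotent k n p) i := by
  obtain ⟨a, rfl⟩ := mkHom_surjective k n p x
  rw [proj_mkHom, mkHom_mem_iff hi, mkHom_mem_iff (hi.trans h)]

theorem ker_proj (h : q ≤ p) : (proj (k := k) (n := n) h).ker =
    lowerCentralSeries k (FreeNilpotent k n p) (FreeNilpotent k n p) q := by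
  ext x
  rw [LieHom.mem_ker, ← LieSubmodule.mem_bot (R := k) (L := FreeNilpotent k n q),
    ← lowerCentralSeries_eq_bot, proj_mem_iff h le_rfl]

theorem homogeneous_eq_map (r : ℕ) : homogeneous k n p r =
    (Submodule.span k {a | IsLieMonomial (FreeLieAlgebra.of k) r a}).map
      (mkHom k n p : FreeLieAlgebra k (Fin n) →ₗ[k] FreeNilpotent k n p) := by
  rw [span_isLieMonomial_map]
  rfl

theorem exists_homogeneous_proj_eq (h : q ≤ p) {r : ℕ} {y : FreeNilpotent k n q}
    (hy : y ∈ homogeneous k n q r) : ∃ x ∈ homogeneous k n p r, proj h x = y := by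
  rw [homogeneous_eq_map] at hy
  obtain ⟨a, ha, rfl⟩ := hy
  exact ⟨mkHom k n p a, by rw [homogeneous_eq_map]; exact ⟨a, ha, rfl⟩, rfl⟩

theorem homogeneous_le_lowerCentralSeries (r : ℕ) : homogeneous k n p r ≤
    (lowerCentralSeries k (FreeNilpotent k n p) (FreeNilpotent k n p) (r - 1)).toSubmodule :=
  Submodule.span_le.2 fun _ h => h.mem_lowerCentralSeries

theorem homogeneous_inf_lowerCentralSeries {r : ℕ} (hr : r ≤ p) : homogeneous k n p r ⊓
    (lowerCentralSeries k (FreeNilpotent k n p) (FreeNilpotent k n p) r).toSubmodule = ⊥ := by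
  rw [eq_bot_iff]
  rintro x ⟨hx, hx'⟩
  rw [SetLike.mem_coe, homogeneous_eq_map] at hx
  obtain ⟨a, ha, rfl⟩ := hx
  rw [eq_zero_of_mem_span_of_mem_lowerCentralSeries k ha ((mkHom_mem_iff hr).1 hx')]
  simp

theorem lowerCentralSeries_le_homogeneous_sup (i : ℕ) :
    (lowerCentralSeries k (FreeNilpotent k n p) (FreeNilpotent k n p) i).toSubmodule ≤
      homogeneous k n p (i + 1) ⊔
        (lowerCentralSeries k (FreeNilpotent k n p) (FreeNilpotent k n p) (i + 1)).toSubmodule := by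
  intro x hx
  rw [LieSubmodule.mem_toSubmodule, ← LieIdeal.lowerCentralSeries_map_eq i
    (mkHom_surjective k n p)] at hx
  obtain ⟨⟨a, ha⟩, rfl⟩ := LieIdeal.mem_map_of_surjective (mkHom_surjective k n p) hx
  obtain ⟨b, ⟨hb, -⟩, c, hc, rfl⟩ :=
    Submodule.mem_sup.1 (lowerCentralSeries_freeLieAlgebra_le k i ha)
  change mkHom k n p (b + c) ∈ _
  rw [map_add]
  refine Submodule.add_mem_sup ?_ (LieIdeal.map_lowerCentralSeries_le _ (LieIdeal.mem_map hc))
  rw [homogeneous_eq_map]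
  exact ⟨b, hb, rfl⟩

theorem homogeneous_one : homogeneous k n p 1 = Submodule.span k (Set.range (gen k n p)) := by
  have (r : ℕ) (a : FreeNilpotent k n p) (h : IsLieMonomial (gen k n p) r a) (hr : r = 1) :
      a ∈ Set.range (gen k n p) := by
    cases h with
    | gen i => exact ⟨i, rfl⟩
    | lie ha hb =>
      have := ha.one_le
      have := hb.one_le
      omega
  refine congrArg _ (Set.Subset.antisymm (fun a h => this 1 a h rfl) ?_)
  rintro _ ⟨i, rfl⟩
  exact .gen i

variable (k n p) in
theorem span_gen_sup_lowerCentralSeries : Submodule.span k (Set.range (gen k n p)) ⊔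
    (lowerCentralSeries k (FreeNilpotent k n p) (FreeNilpotent k n p) 1).toSubmodule = ⊤ := by
  rw [← homogeneous_one]
  simpa using (lowerCentralSeries_le_homogeneous_sup (k := k) (n := n) (p := p) 0)

instance : FiniteDimensional k (FreeNilpotent k n p) :=
  have : FiniteDimensional k (Submodule.span k (Set.range (gen k n p))) :=
    FiniteDimensional.span_of_finite k (Set.finite_range _)
  finiteDimensional_of_generators _ (span_gen_sup_lowerCentralSeries k n p)
    lowerCentralSeries_eq_bot

theorem mem_lowerCentralSeries_of_lie_gen_mem (x : Fin n) {i : ℕ} (hi : 1 ≤ i) (hp : i + 2 ≤ p)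
    {z : FreeNilpotent k n p}
    (hz : z ∈ lowerCentralSeries k (FreeNilpotent k n p) (FreeNilpotent k n p) i)
    (h : ⁅gen k n p x, z⁆ ∈
      lowerCentralSeries k (FreeNilpotent k n p) (FreeNilpotent k n p) (i + 2)) :
    z ∈ lowerCentralSeries k (FreeNilpotent k n p) (FreeNilpotent k n p) (i + 1) := by
  obtain ⟨a, rfl⟩ := mkHom_surjective k n p z
  rw [← mkHom_of, ← LieHom.map_lie, mkHom_mem_iff hp] at h
  rw [mkHom_mem_iff (by omega)] at hz ⊢
  exact mem_lowerCentralSeries_of_lie_of_mem k x hi hz h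

open LieModule.Cohomology in
-- The covering algebra needs one step more than `g`: if `b` lies in the last nonzero layer of the
-- cover, its image in `g` is zero. So the form on the free Lie algebra kills `⁅a, b⁆` and descends.
theorem b2_add_finrank {g : Type v} [LieRing g] [LieAlgebra k g]
    (hg : lowerCentralSeries k g g q = ⊥) (hqp : q < p) (φ : FreeNilpotent k n p →ₗ⁅k⁆ g)
    (hφ : Function.Surjective φ)
    (hker : φ.ker ≤ lowerCentralSeries k (FreeNilpotent k n p) (FreeNilpotent k n p) 1) :
    b2 k g + Module.finrank k (⁅(⊤ : LieIdeal k (FreeNilpotent k n p)), φ.ker⁆).toSubmodule =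
      Module.finrank k φ.ker.toSubmodule := by
  refine b2_add_finrank_lie_ker φ hφ hker fun ω => ?_
  obtain ⟨f, hf⟩ := exists_form_freeLieAlgebra (φ.comp (mkHom k n p)) ω
  obtain ⟨p, rfl⟩ : ∃ p', p = p' + 1 := ⟨p - 1, by omega⟩
  refine ⟨(lcsTerm k (FreeLieAlgebra k (Fin n)) (p + 1 + 1)).toSubmodule.liftQ f ?_, ?_⟩
  · intro z hz
    change z ∈ (lowerCentralSeries k _ _ (p + 1)).toSubmodule at hz
    rw [LieModule.lowerCentralSeries_succ, LieSubmodule.lieIdeal_oper_eq_linear_span'] at hz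
    refine Submodule.span_le.2 ?_ hz
    rintro _ ⟨a, -, b, hb, rfl⟩
    have hb₁ : φ (mkHom k n (p + 1) b) ∈ lowerCentralSeries k g g p :=
      LieIdeal.map_lowerCentralSeries_le p
        (LieIdeal.mem_map ((mkHom_mem_iff (Nat.le_succ p)).2 hb))
    have hb₂ := LieModule.antitone_lowerCentralSeries k g g (Nat.lt_succ_iff.1 hqp) hb₁
    rw [hg, LieSubmodule.mem_bot] at hb₂
    apply (TrivialLieModule.equiv k g k).symm.injective
    rw [hf, LieHom.comp_apply, LieHom.comp_apply, hb₂, map_zero, map_zero]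
  · intro x y
    obtain ⟨a, rfl⟩ := mkHom_surjective k n (p + 1) x
    obtain ⟨b, rfl⟩ := mkHom_surjective k n (p + 1) y
    exact hf a b

/-- The second Betti number of a free nilpotent Lie algebra is the dimension of the first
lower central quotient that it omits. -/
theorem b2_freeNilpotent (hq : 1 ≤ q) (h : q < p) : b2 k (FreeNilpotent k n q) +
    Module.finrank k (lowerCentralSeries k (FreeNilpotent k n p) (FreeNilpotent k n p)
      (q + 1)).toSubmodule =
    Module.finrank k (lowerCentralSeries k (FreeNilpotent k n p) (FreeNilpotent k n p)
      q).toSubmodule := by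
  have h₁ := b2_add_finrank lowerCentralSeries_eq_bot h (proj (k := k) (n := n) h.le)
    (proj_surjective h.le)
    (by rw [ker_proj]; exact LieModule.antitone_lowerCentralSeries k _ _ hq)
  rwa [ker_proj, ← LieModule.lowerCentralSeries_succ] at h₁

end FreeNilpotent

/-! ### Dimension estimates for brackets with an ideal -/

section Bounds

variable {k : Type u} [Field k] {Q : Type v} [LieRing Q] [LieAlgebra k Q]

theorem finrank_map_add_finrank_inf_ker {V : Type v} {W : Type w} [AddCommGroup V] [Module k V]
    [AddCommGroup W] [Module k W] (f : V →ₗ[k] W) (N : Submodule k V) [FiniteDimensional k N] :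
    finrank k (N.map f) + finrank k (N ⊓ LinearMap.ker f : Submodule k V) = finrank k N := by
  have h := (f.domRestrict N).finrank_range_add_finrank_ker
  rw [LinearMap.range_domRestrict] at h
  rw [← h, add_right_inj]
  have h₁ : LinearMap.ker (f.domRestrict N) =
      (N ⊓ LinearMap.ker f : Submodule k V).comap N.subtype := by
    ext x
    simp
  rw [h₁]
  exact (Submodule.comapSubtypeEquivOfLe inf_le_left).finrank_eq.symm

variable {n : ℕ} {x : Fin n → Q}

/-- Only brackets with the generators need checking: by Jacobi the derived algebra contributes to
`[Q, [Q, I]] ≤ [Q, J]`. -/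
theorem lie_top_le_sup_span
    (hx : Submodule.span k (Set.range x) ⊔ (lowerCentralSeries k Q Q 1).toSubmodule = ⊤)
    {I J : LieIdeal k Q} (hIJ : ⁅(⊤ : LieIdeal k Q), I⁆ ≤ J) {P : Submodule k Q}
    (hP : ∀ i, ∀ y ∈ I, ⁅x i, y⁆ ∈ P ⊔ (⁅(⊤ : LieIdeal k Q), J⁆).toSubmodule) :
    (⁅(⊤ : LieIdeal k Q), I⁆).toSubmodule ≤ P ⊔ (⁅(⊤ : LieIdeal k Q), J⁆).toSubmodule := by
  rw [LieSubmodule.lieIdeal_oper_eq_linear_span', Submodule.span_le]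
  rintro _ ⟨a, -, y, hy, rfl⟩
  obtain ⟨b, hb, c, hc, rfl⟩ := Submodule.mem_sup.1 (hx.ge (Submodule.mem_top (x := a)))
  rw [add_lie]
  refine add_mem ?_ (Submodule.mem_sup_right ?_)
  · refine lie_mem_of_mem_span (T := I) ?_ hb (Submodule.subset_span hy)
    rintro _ ⟨i, rfl⟩ y hy
    exact hP i y hy
  · exact LieSubmodule.mono_lie_right _ hIJ (lie_mem_lie_lie_of_mem_derived I hc hy)

/-- If `J ≤ I` are ideals with `⁅Q, I⁆ ≤ J`, then `dim ⁅Q, I⁆ / ⁅Q, J⁆ ≤ n * dim I / J`, for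
a Lie algebra `Q` with `n` generators. -/
theorem finrank_lie_top_add_le [FiniteDimensional k Q]
    (hx : Submodule.span k (Set.range x) ⊔ (lowerCentralSeries k Q Q 1).toSubmodule = ⊤)
    {I J : LieIdeal k Q} (hJI : J ≤ I) (hIJ : ⁅(⊤ : LieIdeal k Q), I⁆ ≤ J) :
    finrank k (⁅(⊤ : LieIdeal k Q), I⁆).toSubmodule + n * finrank k J.toSubmodule ≤
      finrank k (⁅(⊤ : LieIdeal k Q), J⁆).toSubmodule + n * finrank k I.toSubmodule := by
  obtain ⟨C, hC⟩ := Submodule.exists_isCompl J.toSubmodule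
  -- `t` is a complement of `J` in `I`; the `n` maps `⁅x i, ·⁆` on it span `[Q, I]` modulo `[Q, J]`.
  let t : Submodule k Q := C ⊓ I.toSubmodule
  have hsup : J.toSubmodule ⊔ t = I.toSubmodule := by
    rw [← sup_inf_assoc_of_le C (show J.toSubmodule ≤ I.toSubmodule from hJI), hC.sup_eq_top,
      top_inf_eq]
  have hinf : J.toSubmodule ⊓ t = ⊥ := by
    rw [← inf_assoc, hC.inf_eq_bot, bot_inf_eq]
  have ht := Submodule.finrank_sup_add_finrank_inf_eq J.toSubmodule t
  rw [hsup, hinf, finrank_bot, add_zero] at ht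
  let f : (Fin n → t) →ₗ[k] Q :=
    ∑ i, (LieModule.toEnd k Q Q (x i)) ∘ₗ t.subtype ∘ₗ LinearMap.proj i
  have hf (v : Fin n → t) : f v = ∑ i, ⁅x i, (v i : Q)⁆ := by
    simp [f]
  have h₁ := lie_top_le_sup_span hx hIJ (P := LinearMap.range f) (by
    intro i y hy
    obtain ⟨a, ha, b, hb, rfl⟩ := Submodule.mem_sup.1 (hsup.ge hy)
    rw [lie_add]
    refine add_mem (Submodule.mem_sup_right
      (LieSubmodule.lie_mem_lie (LieSubmodule.mem_top (x i)) ha)) (Submodule.mem_sup_left ?_)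
    refine ⟨Pi.single i ⟨b, hb⟩, ?_⟩
    rw [hf, Finset.sum_eq_single i]
    · simp
    · intro j _ hj
      simp [hj]
    · simp)
  have h₂ := (Submodule.finrank_mono h₁).trans (Submodule.finrank_add_le_finrank_add_finrank _ _)
  have h₃ := LinearMap.finrank_range_le f
  rw [Module.finrank_pi_fintype, Finset.sum_const, Finset.card_univ, Fintype.card_fin,
    smul_eq_mul] at h₃
  rw [ht, mul_add]
  omega

/-- Modulo the next term the derived algebra is spanned by the brackets `⁅x i, x j⁆` with `j < i`.
-/
theorem finrank_derived_le [FiniteDimensional k Q]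
    (hx : Submodule.span k (Set.range x) ⊔ (lowerCentralSeries k Q Q 1).toSubmodule = ⊤) :
    finrank k (lowerCentralSeries k Q Q 1).toSubmodule ≤
      n.choose 2 + finrank k (lowerCentralSeries k Q Q 2).toSubmodule := by
  classical
  let S : Finset (Σ _ : Fin n, Fin n) := Finset.univ.sigma fun i => Finset.Iio i
  have hS : S.card = n.choose 2 := by
    rw [Finset.card_sigma]
    simp only [Fin.card_Iio]
    rw [Fin.sum_univ_eq_sum_range (fun i => i), Finset.sum_range_id, Nat.choose_two_right]
  let P : Submodule k Q := Submodule.span k (S.image fun q => ⁅x q.1, x q.2⁆)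
  have hP : finrank k P ≤ n.choose 2 := by
    rw [← hS]
    exact (finrank_span_finset_le_card _).trans Finset.card_image_le
  have key (i j : Fin n) : ⁅x i, x j⁆ ∈ P := by
    have h (i j : Fin n) (hij : j < i) : ⁅x i, x j⁆ ∈ P :=
      Submodule.subset_span (Finset.mem_coe.2 (Finset.mem_image.2
        ⟨⟨i, j⟩, by simpa [S] using hij, rfl⟩))
    rcases lt_trichotomy i j with hij | rfl | hij
    · rw [← lie_skew]
      exact neg_mem (h j i hij)
    · simp
    · exact h i j hij
  have h₁ := lie_top_le_sup_span hx (I := ⊤) (J := lowerCentralSeries k Q Q 1)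
    (by rw [LieModule.lowerCentralSeries_succ, LieModule.lowerCentralSeries_zero]) (P := P) (by
    intro i y _
    obtain ⟨b, hb, c, hc, rfl⟩ := Submodule.mem_sup.1 (hx.ge (Submodule.mem_top (x := y)))
    rw [lie_add]
    refine add_mem (Submodule.mem_sup_left ?_) (Submodule.mem_sup_right
      (LieSubmodule.lie_mem_lie (LieSubmodule.mem_top (x i)) hc))
    refine lie_mem_of_mem_span (S := {x i}) ?_ (Submodule.mem_span_singleton_self _) hb
    rintro _ rfl _ ⟨j, rfl⟩
    exact key i j)
  have e : ⁅(⊤ : LieIdeal k Q), (⊤ : LieIdeal k Q)⁆ = lowerCentralSeries k Q Q 1 := by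
    rw [LieModule.lowerCentralSeries_succ, LieModule.lowerCentralSeries_zero]
  rw [← LieModule.lowerCentralSeries_succ, e, one_add_one_eq_two] at h₁
  have h₂ := (Submodule.finrank_mono h₁).trans (Submodule.finrank_add_le_finrank_add_finrank _ _)
  omega

/-- The bound for `dim r / ⁅Q, r⁆` in terms of the number of generators and the codimension of
`r` in the derived algebra. -/
theorem finrank_sub_finrank_lie_top_le [FiniteDimensional k Q]
    (hx : Submodule.span k (Set.range x) ⊔ (lowerCentralSeries k Q Q 1).toSubmodule = ⊤) {q : ℕ}
    (hq : lowerCentralSeries k Q Q q = ⊥) (r : LieIdeal k Q) (hr : r ≤ lowerCentralSeries k Q Q 1) :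
    (finrank k r.toSubmodule : ℤ) - finrank k (⁅(⊤ : LieIdeal k Q), r⁆).toSubmodule ≤
      (n.choose 2 : ℤ) + ((finrank k (lowerCentralSeries k Q Q 1).toSubmodule : ℤ) -
        finrank k r.toSubmodule) * ((n : ℤ) - 1) := by
  -- The ideals `r ⊔ lowerCentralSeries k Q Q (i + 1)` descend from the derived algebra to `r`. A
  -- drop by `δ` lowers the dimension of the bracket ideal by at most `n * δ`, a net cost of `(n -
  -- 1) * δ`.
  have key (i : ℕ) :
      (finrank k (r ⊔ lowerCentralSeries k Q Q (i + 1)).toSubmodule : ℤ) -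
        finrank k (⁅(⊤ : LieIdeal k Q), r ⊔ lowerCentralSeries k Q Q (i + 1)⁆).toSubmodule ≤
      (n.choose 2 : ℤ) + ((finrank k (lowerCentralSeries k Q Q 1).toSubmodule : ℤ) -
        finrank k (r ⊔ lowerCentralSeries k Q Q (i + 1)).toSubmodule) * ((n : ℤ) - 1) := by
    induction i with
    | zero =>
      rw [zero_add, sup_eq_right.2 hr, sub_self, zero_mul, add_zero,
        ← LieModule.lowerCentralSeries_succ]
      have := finrank_derived_le hx
      push_cast [← Nat.cast_le (α := ℤ)] at this
      linarith
    | succ i ih =>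
      have h := finrank_lie_top_add_le hx (I := r ⊔ lowerCentralSeries k Q Q (i + 1))
        (J := r ⊔ lowerCentralSeries k Q Q (i + 1 + 1))
        (sup_le_sup_left (LieModule.antitone_lowerCentralSeries k _ _ (Nat.le_succ _)) _)
        (by
          rw [LieSubmodule.lie_sup, ← LieModule.lowerCentralSeries_succ]
          exact sup_le_sup_right (LieSubmodule.lie_le_right r ⊤) _)
      have h : ((_ : ℕ) : ℤ) ≤ _ := Nat.cast_le.2 h
      push_cast at h
      linarith
  have h := key q
  rwa [eq_bot_iff.2 ((LieModule.antitone_lowerCentralSeries k _ _ (Nat.le_succ q)).trans hq.le),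
    sup_bot_eq] at h

end Bounds

/-! ### Lower central quotients under surjections -/

section Quotients

variable {k : Type u} [Field k] {Q : Type v} [LieRing Q] [LieAlgebra k Q]
  {g : Type w} [LieRing g] [LieAlgebra k g]

theorem lcsQuotientDim_add [FiniteDimensional k g] (i : ℕ) :
    lcsQuotientDim k g (i + 1) + finrank k (lowerCentralSeries k g g (i + 1)).toSubmodule =
      finrank k (lowerCentralSeries k g g i).toSubmodule := by
  have h := Submodule.finrank_quotient_add_finrank
    ((lcsTerm k g (i + 1 + 1)).toSubmodule.submoduleOf (lcsTerm k g (i + 1)).toSubmodule)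
  rw [(Submodule.submoduleOfEquivOfLe (show (lcsTerm k g (i + 1 + 1)).toSubmodule ≤
    (lcsTerm k g (i + 1)).toSubmodule from
    LieModule.antitone_lowerCentralSeries k g g (Nat.le_succ i))).finrank_eq] at h
  exact h

theorem finrank_lowerCentralSeries_add [FiniteDimensional k Q] (φ : Q →ₗ⁅k⁆ g)
    (hφ : Function.Surjective φ) (i : ℕ) :
    finrank k (lowerCentralSeries k g g i).toSubmodule +
      finrank k (φ.ker ⊓ lowerCentralSeries k Q Q i).toSubmodule =
      finrank k (lowerCentralSeries k Q Q i).toSubmodule := by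
  have h := finrank_map_add_finrank_inf_ker (φ : Q →ₗ[k] g)
    (lowerCentralSeries k Q Q i).toSubmodule
  rw [← LieHom.ker_toSubmodule, inf_comm, ← LieIdeal.coe_map_of_surjective hφ,
    LieIdeal.lowerCentralSeries_map_eq i hφ] at h
  exact h

end Quotients

/-! ### Existence of free nilpotent extensions -/

section Existence

variable {k : Type u} [Field k] {g : Type v} [LieRing g] [LieAlgebra k g] [FiniteDimensional k g]

/-- A nilpotent Lie algebra has a free nilpotent extension. -/
theorem exists_isFreeNilpotentExtension {p : ℕ}
    (hg : lowerCentralSeries k g g p = ⊥) :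
    ∃ π : FreeNilpotent k (lcsQuotientDim k g 1) p →ₗ⁅k⁆ g, IsFreeNilpotentExtension π := by
  set n := lcsQuotientDim k g 1 with hn
  obtain ⟨V, hV⟩ := Submodule.exists_isCompl (lowerCentralSeries k g g 1).toSubmodule
  have hVn : finrank k V = n := by
    have h₁ := lcsQuotientDim_add (k := k) (g := g) 0
    have h₂ := Submodule.finrank_add_eq_of_isCompl hV
    rw [LieModule.lowerCentralSeries_zero, LieSubmodule.top_toSubmodule, finrank_top, zero_add,
      ← hn] at h₁
    omega
  let e := Module.finBasisOfFinrankEq k V hVn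
  let π : FreeNilpotent k n p →ₗ⁅k⁆ g :=
    FreeNilpotent.liftHom (FreeLieAlgebra.lift k fun i => (e i : g)) hg
  have hπ (i : Fin n) : π (FreeNilpotent.gen k n p i) = e i := by
    rw [← FreeNilpotent.mkHom_of, FreeNilpotent.liftHom_mkHom, FreeLieAlgebra.lift_of_apply]
  have hVr : V ≤ LinearMap.range (π : FreeNilpotent k n p →ₗ[k] g) := by
    intro v hv
    have h := e.sum_repr ⟨v, hv⟩
    refine ⟨∑ i, e.repr ⟨v, hv⟩ i • FreeNilpotent.gen k n p i, ?_⟩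
    have h := congrArg Subtype.val h
    simp only [AddSubmonoidClass.coe_finsetSum, Submodule.coe_smul] at h
    refine Eq.trans ?_ h
    rw [map_sum]
    exact Finset.sum_congr rfl fun i _ => by
      rw [map_smul]
      exact congrArg _ (hπ i)
  refine ⟨π, rfl, ?_, ?_⟩
  -- The range is closed under brackets and contains a complement of the derived algebra, so it
  -- fills `g` modulo every term of the series.
  · have key (i : ℕ) : LinearMap.range (π : FreeNilpotent k n p →ₗ[k] g) ⊔
        (lowerCentralSeries k g g i).toSubmodule = ⊤ := by
      induction i with
      | zero => simp
      | succ i ih =>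
        rw [eq_top_iff, ← ih]
        refine sup_le le_sup_left ((lowerCentralSeries_le_sup
          (fun _ => LinearMap.range (π : FreeNilpotent k n p →ₗ[k] g)) ?_ ?_ i).trans
          (sup_le_sup_right inf_le_left _))
        · rw [eq_top_iff, ← hV.sup_eq_top, sup_comm]
          exact sup_le_sup_right hVr _
        · rintro _ _ ⟨a, rfl⟩ _ ⟨b, rfl⟩
          exact ⟨⁅a, b⁆, LieHom.map_lie π a b⟩
    have h := key p
    rw [hg, LieSubmodule.bot_toSubmodule, sup_bot_eq] at h
    exact LinearMap.range_eq_top.1 h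
  · intro y hy
    obtain ⟨a, ha, z, hz, rfl⟩ := Submodule.mem_sup.1
      ((FreeNilpotent.span_gen_sup_lowerCentralSeries k n p).ge (Submodule.mem_top (x := y)))
    obtain ⟨c, rfl⟩ := (Submodule.mem_span_range_iff_exists_fun k).1 ha
    have h₁ : π (∑ i, c i • FreeNilpotent.gen k n p i) = ((∑ i, c i • e i : V) : g) := by
      rw [map_sum, AddSubmonoidClass.coe_finsetSum]
      exact Finset.sum_congr rfl fun i _ => by rw [map_smul, hπ, Submodule.coe_smul]
    have h₂ : π z ∈ lowerCentralSeries k g g 1 :=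
      LieIdeal.map_lowerCentralSeries_le 1 (LieIdeal.mem_map hz)
    -- For `y` in the kernel, the image of its linear part lies both in `V` and in the derived
    -- algebra.
    have h₃ : ((∑ i, c i • e i : V) : g) = 0 := by
      rw [LieHom.mem_ker, map_add, h₁, add_eq_zero_iff_eq_neg] at hy
      have h₄ := hV.inf_eq_bot.le ⟨by rw [hy]; exact neg_mem h₂, (∑ i, c i • e i : V).2⟩
      exact h₄
    have h₄ := Fintype.linearIndependent_iff.1 e.linearIndependent c (Subtype.ext h₃)
    simpa [h₄] using hz

end Existence

/-! ### Bounds from the cover with one more step -/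

section Extensions

variable {k : Type u} [Field k] {g : Type v} [LieRing g] [LieAlgebra k g]
  {n p : ℕ} {π : FreeNilpotent k n p →ₗ⁅k⁆ g}

/-- The map from the free `(p + 1)`-step nilpotent Lie algebra induced by a free `p`-step
nilpotent extension. -/
def coverHom (π : FreeNilpotent k n p →ₗ⁅k⁆ g) : FreeNilpotent k n (p + 1) →ₗ⁅k⁆ g :=
  π.comp (FreeNilpotent.proj (Nat.le_succ p))

theorem IsFreeNilpotentExtension.coverHom_surjective (hπ : IsFreeNilpotentExtension π) :
    Function.Surjective (coverHom π) :=
  hπ.surjective.comp (FreeNilpotent.proj_surjective _)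

theorem mem_ker_coverHom {x : FreeNilpotent k n (p + 1)} :
    x ∈ (coverHom π).ker ↔ FreeNilpotent.proj (Nat.le_succ p) x ∈ π.ker := by
  rw [LieHom.mem_ker, LieHom.mem_ker]
  rfl

theorem lowerCentralSeries_le_ker_coverHom :
    lowerCentralSeries k (FreeNilpotent k n (p + 1)) (FreeNilpotent k n (p + 1)) p ≤
      (coverHom π).ker := by
  rw [← FreeNilpotent.ker_proj (Nat.le_succ p)]
  intro x hx
  rw [mem_ker_coverHom, LieHom.mem_ker.1 hx]
  exact zero_mem _

theorem ker_coverHom_le {i : ℕ} (hi : i ≤ p)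
    (h : π.ker ≤ lowerCentralSeries k (FreeNilpotent k n p) (FreeNilpotent k n p) i) :
    (coverHom π).ker ≤
      lowerCentralSeries k (FreeNilpotent k n (p + 1)) (FreeNilpotent k n (p + 1)) i := by
  intro x hx
  rw [mem_ker_coverHom] at hx
  exact (FreeNilpotent.proj_mem_iff (Nat.le_succ p) hi).1 (h hx)

theorem IsFreeNilpotentExtension.b2_add (hπ : IsFreeNilpotentExtension π) (hp : 1 ≤ p)
    (hg : lowerCentralSeries k g g p = ⊥) :
    b2 k g + finrank k
      (⁅(⊤ : LieIdeal k (FreeNilpotent k n (p + 1))), (coverHom π).ker⁆).toSubmodule =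
      finrank k (coverHom π).ker.toSubmodule :=
  FreeNilpotent.b2_add_finrank hg (Nat.lt_succ_self p) _ hπ.coverHom_surjective
    (ker_coverHom_le hp hπ.ker_le)

variable [FiniteDimensional k g]

theorem IsFreeNilpotentExtension.b2_le (hπ : IsFreeNilpotentExtension π) (hp : 1 ≤ p)
    (hg : lowerCentralSeries k g g p = ⊥) :
    (b2 k g : ℤ) ≤ (n.choose 2 : ℤ) + ((finrank k g : ℤ) - n) * ((n : ℤ) - 1) := by
  have h₁ := hπ.b2_add hp hg
  have hker := ker_coverHom_le hp hπ.ker_le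
  have h₂ := finrank_sub_finrank_lie_top_le
    (FreeNilpotent.span_gen_sup_lowerCentralSeries k n (p + 1))
    FreeNilpotent.lowerCentralSeries_eq_bot (coverHom π).ker hker
  have h₃ := lcsQuotientDim_add (k := k) (g := g) 0
  rw [zero_add, ← hπ.rank_eq] at h₃
  have h₄ := finrank_lowerCentralSeries_add (coverHom π) hπ.coverHom_surjective 1
  rw [inf_eq_left.2 hker] at h₄
  rw [LieModule.lowerCentralSeries_zero, LieSubmodule.top_toSubmodule, finrank_top] at h₃
  zify at h₁ h₃ h₄
  -- Both sides are the dimension of the derived algebra of `g`.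
  have e : (finrank k g : ℤ) - n = (finrank k (lowerCentralSeries k (FreeNilpotent k n (p + 1))
      (FreeNilpotent k n (p + 1)) 1).toSubmodule : ℤ) -
        finrank k (coverHom π).ker.toSubmodule := by
    linarith
  rw [e]
  linarith

/-- For a kernel that is contained in the `d`-th term of the lower central series, the difference
`b₂(f_{n,d-1}) - n_d` is the dimension of the image of the kernel in the `d`-th lower central
quotient. -/
theorem IsFreeNilpotentExtension.b2_freeNilpotent_sub (hπ : IsFreeNilpotentExtension π) {d : ℕ}
    (hd : 1 ≤ d) (hdp : d + 1 ≤ p)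
    (h : π.ker ≤ lowerCentralSeries k (FreeNilpotent k n p) (FreeNilpotent k n p) d) :
    (b2 k (FreeNilpotent k n d) : ℤ) - lcsQuotientDim k g (d + 1) =
      finrank k (coverHom π).ker.toSubmodule - finrank k ((coverHom π).ker ⊓
        lowerCentralSeries k (FreeNilpotent k n (p + 1)) (FreeNilpotent k n (p + 1))
          (d + 1)).toSubmodule := by
  have h₁ := FreeNilpotent.b2_freeNilpotent (k := k) (n := n) (p := p + 1) hd (by omega)
  have h₂ := lcsQuotientDim_add (k := k) (g := g) d
  have h₃ := finrank_lowerCentralSeries_add (coverHom π) hπ.coverHom_surjective d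
  have h₄ := finrank_lowerCentralSeries_add (coverHom π) hπ.coverHom_surjective (d + 1)
  rw [inf_eq_left.2 (ker_coverHom_le (by omega) h)] at h₃
  omega

/-- Bracketing moves the kernel one term deeper, so its image in the leading lower central quotient
survives in `r / [F, r]`. -/
theorem IsFreeNilpotentExtension.sub_le_b2 (hπ : IsFreeNilpotentExtension π)
    (hg : lowerCentralSeries k g g p = ⊥) {d : ℕ} (hd : 1 ≤ d) (hdp : d + 1 ≤ p)
    (h : π.ker ≤ lowerCentralSeries k (FreeNilpotent k n p) (FreeNilpotent k n p) d) :
    (b2 k (FreeNilpotent k n d) : ℤ) - lcsQuotientDim k g (d + 1) ≤ b2 k g := by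
  rw [hπ.b2_freeNilpotent_sub hd hdp h]
  have h₁ := hπ.b2_add (by omega) hg
  have h₂ : finrank k
      (⁅(⊤ : LieIdeal k (FreeNilpotent k n (p + 1))), (coverHom π).ker⁆).toSubmodule ≤
      finrank k ((coverHom π).ker ⊓ lowerCentralSeries k (FreeNilpotent k n (p + 1))
        (FreeNilpotent k n (p + 1)) (d + 1)).toSubmodule := by
    refine Submodule.finrank_mono (le_inf (LieSubmodule.lie_le_right _ ⊤) ?_)
    rw [LieModule.lowerCentralSeries_succ]
    exact LieSubmodule.mono_lie_right _ (ker_coverHom_le (by omega) h)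
  omega

end Extensions

/-! ### Sharper bounds for kernels generated in one degree -/

section Sharper

variable {k : Type u} [Field k] {g : Type v} [LieRing g] [LieAlgebra k g]
  {n q : ℕ} {π : FreeNilpotent k n (q + 1) →ₗ⁅k⁆ g}

theorem GeneratedInDegree.le_lowerCentralSeries {p r : ℕ} {N : LieIdeal k (FreeNilpotent k n p)}
    (hN : GeneratedInDegree N r) :
    N ≤ lowerCentralSeries k (FreeNilpotent k n p) (FreeNilpotent k n p) (r - 1) := by
  obtain ⟨S, hS, rfl⟩ := hN
  exact LieSubmodule.lieSpan_le.2 (hS.trans (FreeNilpotent.homogeneous_le_lowerCentralSeries r))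

/-- The last nonzero layer is homogeneous, so depth `p` is a special case of generation in one
degree. -/
theorem generatedInDegree_of_le {N : LieIdeal k (FreeNilpotent k n (q + 1))}
    (h : N ≤ lowerCentralSeries k (FreeNilpotent k n (q + 1)) (FreeNilpotent k n (q + 1)) q) :
    GeneratedInDegree N (q + 1) := by
  refine ⟨N, fun x hx => ?_, (LieSubmodule.lieSpan_eq N).symm⟩
  have h₁ := FreeNilpotent.lowerCentralSeries_le_homogeneous_sup q (h hx)
  rwa [FreeNilpotent.lowerCentralSeries_eq_bot, LieSubmodule.bot_toSubmodule, sup_bot_eq] at h₁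

theorem ker_coverHom_le_ideal {d : ℕ} (hN : GeneratedInDegree π.ker d)
    (I : LieIdeal k (FreeNilpotent k n (q + 1 + 1)))
    (h₁ : homogeneous k n (q + 1 + 1) d ⊓ (coverHom π).ker.toSubmodule ≤ I.toSubmodule)
    (h₂ : lowerCentralSeries k (FreeNilpotent k n (q + 1 + 1)) (FreeNilpotent k n (q + 1 + 1))
      (q + 1) ≤ I) : (coverHom π).ker ≤ I := by
  obtain ⟨S, hS, hSN⟩ := hN
  have hmap : π.ker ≤ LieIdeal.map (FreeNilpotent.proj (Nat.le_succ (q + 1))) I := by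
    rw [hSN, LieSubmodule.lieSpan_le]
    intro s hs
    obtain ⟨x, hx, rfl⟩ := FreeNilpotent.exists_homogeneous_proj_eq (Nat.le_succ (q + 1)) (hS hs)
    refine LieIdeal.mem_map (h₁ ⟨hx, ?_⟩)
    rw [SetLike.mem_coe, LieSubmodule.mem_toSubmodule, mem_ker_coverHom, hSN]
    exact LieSubmodule.subset_lieSpan hs
  intro y hy
  obtain ⟨⟨z, hz⟩, hzy⟩ := LieIdeal.mem_map_of_surjective
    (FreeNilpotent.proj_surjective (Nat.le_succ (q + 1))) (hmap (mem_ker_coverHom.1 hy))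
  have h₃ : y - z ∈ (FreeNilpotent.proj (k := k) (n := n) (Nat.le_succ (q + 1))).ker := by
    rw [LieHom.mem_ker, map_sub, sub_eq_zero]
    exact hzy.symm
  rw [FreeNilpotent.ker_proj] at h₃
  have h₄ := add_mem (h₂ h₃) hz
  rwa [sub_add_cancel] at h₄

theorem exists_lieIdeal_toSubmodule_eq {L : Type v} [LieRing L] [LieAlgebra k L]
    (I : LieIdeal k L) (P : Submodule k L) (hP : P ≤ I.toSubmodule)
    (h : (⁅(⊤ : LieIdeal k L), I⁆).toSubmodule ≤ P) : ∃ J : LieIdeal k L, J.toSubmodule = P :=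
  ⟨{ P with lie_mem := fun {x _} hy => h (LieSubmodule.lie_mem_lie (LieSubmodule.mem_top x)
      (hP hy)) }, rfl⟩

theorem ker_coverHom_le_of_generatedInDegree {d : ℕ} (hN : GeneratedInDegree π.ker d) :
    (coverHom π).ker.toSubmodule ≤
      (homogeneous k n (q + 1 + 1) d ⊓ (coverHom π).ker.toSubmodule) ⊔
        ((⁅(⊤ : LieIdeal k (FreeNilpotent k n (q + 1 + 1))), (coverHom π).ker⁆).toSubmodule ⊔
        (lowerCentralSeries k (FreeNilpotent k n (q + 1 + 1)) (FreeNilpotent k n (q + 1 + 1))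
          (q + 1)).toSubmodule) := by
  have h₀ : (lowerCentralSeries k (FreeNilpotent k n (q + 1 + 1)) (FreeNilpotent k n (q + 1 + 1))
      (q + 1)).toSubmodule ≤ (coverHom π).ker.toSubmodule :=
    lowerCentralSeries_le_ker_coverHom
  have h₁ : (⁅(⊤ : LieIdeal k (FreeNilpotent k n (q + 1 + 1))), (coverHom π).ker⁆).toSubmodule ≤
      (coverHom π).ker.toSubmodule := LieSubmodule.lie_le_right _ ⊤
  -- A subspace between `[F, r]` and `r` is automatically an ideal; hence this sum contains the
  -- ideal generated by lifts of the homogeneous generators.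
  obtain ⟨I, hI⟩ := exists_lieIdeal_toSubmodule_eq (coverHom π).ker _
    (sup_le (inf_le_right (a := homogeneous k n (q + 1 + 1) d)) (sup_le h₁ h₀))
    (le_sup_left.trans le_sup_right)
  rw [← hI]
  have h₂ : (lowerCentralSeries k (FreeNilpotent k n (q + 1 + 1)) (FreeNilpotent k n (q + 1 + 1))
      (q + 1)).toSubmodule ≤ I.toSubmodule := by
    rw [hI]
    exact le_sup_right.trans le_sup_right
  refine ker_coverHom_le_ideal hN I ?_ h₂
  rw [hI]
  exact le_sup_left

variable [FiniteDimensional k g]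

/-- The top layer of the cover is central and lies in `r`, so `dim [F, r]` is at most `n` times the
codimension of that layer in `r`; this codimension is `c`. -/
theorem IsFreeNilpotentExtension.sub_add_le_b2 (hπ : IsFreeNilpotentExtension π) (hq : 1 ≤ q)
    (hg : lowerCentralSeries k g g (q + 1) = ⊥)
    (h : π.ker ≤ lowerCentralSeries k (FreeNilpotent k n (q + 1)) (FreeNilpotent k n (q + 1)) q) :
    (b2 k (FreeNilpotent k n q) : ℤ) - lcsQuotientDim k g (q + 1) +
      (b2 k (FreeNilpotent k n (q + 1)) - n * b2 k (FreeNilpotent k n q) +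
        n * lcsQuotientDim k g (q + 1)) ≤ b2 k g := by
  have h₁ := hπ.b2_add (by omega) hg
  have hker := ker_coverHom_le (Nat.le_succ q) h
  have h₂ := FreeNilpotent.b2_freeNilpotent (k := k) (n := n) (p := q + 1 + 1) hq (by omega)
  have h₃ := FreeNilpotent.b2_freeNilpotent (k := k) (n := n) (p := q + 1 + 1) (q := q + 1)
    (by omega) (by omega)
  have h₄ := lcsQuotientDim_add (k := k) (g := g) q
  have h₅ := finrank_lowerCentralSeries_add (coverHom π) hπ.coverHom_surjective q
  have h₆ := finrank_lie_top_add_le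
    (FreeNilpotent.span_gen_sup_lowerCentralSeries k n (q + 1 + 1))
    (lowerCentralSeries_le_ker_coverHom (π := π))
    (by
      rw [LieModule.lowerCentralSeries_succ]
      exact LieSubmodule.mono_lie_right _ hker)
  rw [← LieModule.lowerCentralSeries_succ] at h₆
  rw [inf_eq_left.2 hker] at h₅
  rw [FreeNilpotent.lowerCentralSeries_eq_bot, LieSubmodule.bot_toSubmodule, finrank_bot] at h₃ h₆
  rw [hg, LieSubmodule.bot_toSubmodule, finrank_bot] at h₄
  zify at h₁ h₂ h₃ h₄ h₅ h₆
  have e : (b2 k (FreeNilpotent k n q) : ℤ) - lcsQuotientDim k g (q + 1) =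
      finrank k (coverHom π).ker.toSubmodule - b2 k (FreeNilpotent k n (q + 1)) := by
    linarith
  have e' := congrArg (fun a => (n : ℤ) * a) e
  simp only [mul_sub] at e'
  have e'' : (b2 k (FreeNilpotent k n (q + 1)) : ℤ) = finrank k (lowerCentralSeries k
    (FreeNilpotent k n (q + 1 + 1)) (FreeNilpotent k n (q + 1 + 1)) (q + 1)).toSubmodule := by
    linarith
  rw [e''] at e e' ⊢
  linarith

theorem IsFreeNilpotentExtension.b2_le_of_generatedInDegree (hπ : IsFreeNilpotentExtension π)
    (hn : 0 < n) (hq : 1 ≤ q) (hg : lowerCentralSeries k g g (q + 1) = ⊥) {d : ℕ} (hd : 1 ≤ d)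
    (hdq : d ≤ q) (hN : GeneratedInDegree π.ker (d + 1)) :
    (b2 k g : ℤ) ≤ (b2 k (FreeNilpotent k n d) : ℤ) - lcsQuotientDim k g (d + 1) +
      b2 k (FreeNilpotent k n (q + 1)) - b2 k (FreeNilpotent k n q) +
        lcsQuotientDim k g (q + 1) := by
  rw [hπ.b2_freeNilpotent_sub hd (by omega) hN.le_lowerCentralSeries]
  have h₁ := hπ.b2_add (by omega) hg
  have h₂ := FreeNilpotent.b2_freeNilpotent (k := k) (n := n) (p := q + 1 + 1) hq (by omega)
  have h₃ := FreeNilpotent.b2_freeNilpotent (k := k) (n := n) (p := q + 1 + 1) (q := q + 1)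
    (by omega) (by omega)
  have h₄ := lcsQuotientDim_add (k := k) (g := g) q
  have h₅ := finrank_lowerCentralSeries_add (coverHom π) hπ.coverHom_surjective q
  rw [FreeNilpotent.lowerCentralSeries_eq_bot, LieSubmodule.bot_toSubmodule, finrank_bot] at h₃
  rw [hg, LieSubmodule.bot_toSubmodule, finrank_bot] at h₄
  have hle := ker_coverHom_le_of_generatedInDegree hN
  set r := (coverHom π).ker with hr
  set Γ := lowerCentralSeries k (FreeNilpotent k n (q + 1 + 1)) (FreeNilpotent k n (q + 1 + 1))
    with hΓ
  set T := homogeneous k n (q + 1 + 1) (d + 1) ⊓ r.toSubmodule with hT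
  have h₆ := (Submodule.finrank_mono hle).trans
    (Submodule.finrank_add_le_finrank_add_finrank _ _)
  -- A homogeneous element of degree `d + 1` in `Γ (d + 1)` is zero, so `T` embeds in the leading
  -- quotient of `r`.
  have h₇ : finrank k T + finrank k (r ⊓ Γ (d + 1)).toSubmodule ≤ finrank k r.toSubmodule := by
    have h := Submodule.finrank_sup_add_finrank_inf_eq T (r ⊓ Γ (d + 1)).toSubmodule
    have h₀ : T ⊓ (r ⊓ Γ (d + 1)).toSubmodule = ⊥ := by
      rw [eq_bot_iff, ← FreeNilpotent.homogeneous_inf_lowerCentralSeries (k := k) (n := n)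
        (p := q + 1 + 1) (r := d + 1) (by omega)]
      exact inf_le_inf inf_le_left inf_le_right
    rw [h₀, finrank_bot, add_zero] at h
    rw [← h]
    exact Submodule.finrank_mono (sup_le inf_le_right inf_le_left)
  have h₈ := Submodule.finrank_sup_add_finrank_inf_eq
    (⁅(⊤ : LieIdeal k (FreeNilpotent k n (q + 1 + 1))), r⁆).toSubmodule (Γ (q + 1)).toSubmodule
  let x := FreeNilpotent.gen k n (q + 1 + 1) ⟨0, hn⟩
  have h₉ := finrank_map_add_finrank_inf_ker
    (LieModule.toEnd k (FreeNilpotent k n (q + 1 + 1)) (FreeNilpotent k n (q + 1 + 1)) x)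
    (r ⊓ Γ q).toSubmodule
  -- `[F, r]` and the top layer overlap at least in the image of `r ⊓ Γ q` under `ad x`; this
  -- overlap improves the bound.
  have h₁₀ := Submodule.finrank_mono (show (r ⊓ Γ q).toSubmodule.map
      (LieModule.toEnd k (FreeNilpotent k n (q + 1 + 1)) (FreeNilpotent k n (q + 1 + 1)) x) ≤
      (⁅(⊤ : LieIdeal k (FreeNilpotent k n (q + 1 + 1))), r⁆).toSubmodule ⊓
        (Γ (q + 1)).toSubmodule from by
    rintro _ ⟨y, ⟨hy, hy'⟩, rfl⟩
    exact ⟨LieSubmodule.lie_mem_lie (LieSubmodule.mem_top x) hy,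
      lie_mem_lowerCentralSeries_succ x hy'⟩)
  -- Injectivity of `ad x` between consecutive layers, which needs `1 ≤ q`.
  have h₁₁ := Submodule.finrank_mono (show (r ⊓ Γ q).toSubmodule ⊓ LinearMap.ker
      (LieModule.toEnd k (FreeNilpotent k n (q + 1 + 1)) (FreeNilpotent k n (q + 1 + 1)) x) ≤
      (Γ (q + 1)).toSubmodule from by
    rintro y ⟨⟨-, hy⟩, hy'⟩
    refine FreeNilpotent.mem_lowerCentralSeries_of_lie_gen_mem ⟨0, hn⟩ hq le_rfl hy ?_
    rw [show ⁅x, y⁆ = 0 from hy']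
    exact zero_mem _)
  omega

end Sharper

theorem FreeNilpotent.subsingleton {k : Type u} [Field k] (p : ℕ) :
    Subsingleton (FreeNilpotent k 0 p) := by
  have h : (LieHom.id : FreeLieAlgebra k (Fin 0) →ₗ⁅k⁆ FreeLieAlgebra k (Fin 0)) = 0 := by
    ext1 i
    exact i.elim0
  refine ⟨fun x y => ?_⟩
  obtain ⟨a, rfl⟩ := mkHom_surjective k 0 p x
  obtain ⟨b, rfl⟩ := mkHom_surjective k 0 p y
  have (a : FreeLieAlgebra k (Fin 0)) : a = 0 := congrArg (fun f => f a) h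
  rw [this a, this b]

end NilpotentBetti

end

/-! ### The bounds on the second Betti number -/

theorem theorem4p6 {k : Type*} [Field k] {g : Type*} [LieRing g] [LieAlgebra k g]
    [FiniteDimensional k g] (p : ℕ) (hp : NilpotentBetti.IsStepNilpotent k g p)
    (n : ℕ → ℕ) (hn : NilpotentBetti.HasType k g p n)
    (m : ℕ) (hm : Module.finrank k g = m)
    (C : ℤ) (hC : C = ((n 1).choose 2 : ℤ) + ((m : ℤ) - n 1) * ((n 1 : ℤ) - 1)) :
    (NilpotentBetti.b2 k g : ℤ) ≤ C ∧
    ∀ (d : ℕ), NilpotentBetti.HasDepth k g p d →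
    ∀ (c U : ℤ),
      c = (NilpotentBetti.b2 k (NilpotentBetti.FreeNilpotent k (n 1) (d - 1)) : ℤ) - n d →
      U = c + NilpotentBetti.b2 k (NilpotentBetti.FreeNilpotent k (n 1) p)
          - NilpotentBetti.b2 k (NilpotentBetti.FreeNilpotent k (n 1) (p - 1)) + n p →
      c ≤ NilpotentBetti.b2 k g ∧
      (∀ π : NilpotentBetti.FreeNilpotent k (n 1) p →ₗ⁅k⁆ g,
        NilpotentBetti.IsFreeNilpotentExtension π →
        NilpotentBetti.GeneratedInDegree π.ker d →
        (NilpotentBetti.b2 k g : ℤ) ≤ min U C) ∧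
      (d = p →
        c + max 0 ((NilpotentBetti.b2 k (NilpotentBetti.FreeNilpotent k (n 1) p) : ℤ)
            - n 1 * NilpotentBetti.b2 k (NilpotentBetti.FreeNilpotent k (n 1) (p - 1))
            + n 1 * n p) ≤ NilpotentBetti.b2 k g ∧
        (NilpotentBetti.b2 k g : ℤ) ≤ min U C) := by
  open NilpotentBetti in
  obtain ⟨hp₁, hp₂, hp₃⟩ := hp
  have hg : LieModule.lowerCentralSeries k g g p = ⊥ := hp₃
  have hn₁ := hn 1 le_rfl hp₁
  have hbC : (b2 k g : ℤ) ≤ C := by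
    obtain ⟨π, hπ⟩ := exists_isFreeNilpotentExtension hg
    rw [hC, ← hm, hn₁]
    exact hπ.b2_le hp₁ hg
  refine ⟨hbC, fun d ⟨n', π, hπ, ⟨hd₂, hdp, hle⟩, _⟩ c U hc hU => ?_⟩
  obtain rfl : n' = n 1 := hπ.rank_eq.trans hn₁.symm
  obtain ⟨q, rfl⟩ : ∃ q, p = q + 1 := ⟨p - 1, by omega⟩
  obtain ⟨d, rfl⟩ : ∃ d', d = d' + 1 := ⟨d - 1, by omega⟩
  -- The sharper upper bound uses `ad` of a generator; without generators `g` would be zero,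
  -- contrary to `hp₂`.
  have hpos : 0 < n 1 := by
    rw [Nat.pos_iff_ne_zero]
    intro h₀
    have : Subsingleton (FreeNilpotent k (n 1) (q + 1)) := by
      rw [h₀]
      exact FreeNilpotent.subsingleton _
    have := hπ.surjective.subsingleton
    exact hp₂ (Subsingleton.elim _ _)
  rw [hn (d + 1) (by omega) hdp, Nat.add_sub_cancel] at hc
  rw [hn (q + 1) hp₁ le_rfl, Nat.add_sub_cancel] at hU ⊢
  have upper (π : FreeNilpotent k (n 1) (q + 1) →ₗ⁅k⁆ g) (hπ : IsFreeNilpotentExtension π)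
      (hN : GeneratedInDegree π.ker (d + 1)) : (b2 k g : ℤ) ≤ min U C := by
    rw [le_min_iff, hU, hc]
    exact ⟨hπ.b2_le_of_generatedInDegree hpos (by omega) hg (by omega) (by omega) hN, hbC⟩
  have lower : c ≤ b2 k g := by
    rw [hc]
    exact hπ.sub_le_b2 hg (by omega) hdp hle
  refine ⟨lower, upper, fun hdq => ?_⟩
  obtain rfl : d = q := by omega
  refine ⟨?_, upper π hπ (generatedInDegree_of_le hle)⟩
  -- The maximum splits into the general lower bound and the one special to depth `p`.
  rw [add_max, add_zero]
  refine max_le lower ?_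
  rw [hc]
  exact hπ.sub_add_le_b2 (by omega) hg hle
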